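/- Let $r,r'\ge 1$, let $A\in\mathbb R^{r\times r}$ and $C\in\mathbb R^{r'\times r}$ be such that $(A,C)$ is observable (the matrix with block rows $C,CA,\dots,CA^{r-1}$ has rank $r$), let $R\in\mathbb R^{r\times r}$ and $\Sigma\in\mathbb R^{r'\times r'}$ be symmetric positive definite, and put $S=C'\Sigma^{-1}C$. Let $T\in\mathbb R^{r\times r}$ be symmetric positive semidefinite and, for $\epsilon\in[0,1]$, set $\pi_\epsilon(Q)=Q+\epsilon T$. Write $\mathbb S_r^+$ for the symmetric positive semidefinite $r\times r$ matrices and $\|\cdot\|_2$ for the spectral norm. Let $\mathrm{Ricc}(Q)=AQ+QA'-QSQ+R$ and, for a mapping $\pi:\mathbb S_r^+\to\mathbb S_r^+$, $$\mathrm{Ricc}^{\pi}(Q)=(A-\pi(Q)S)Q+Q(A-\pi(Q)S)'+R+\pi(Q)S\pi(Q).$$ Let $t\mapsto\phi_t(Q)$ and $t\mapsto\phi^{\pi}_t(Q)$ denote the solutions on $[0,\infty)$ in $\mathbb S_r^+$, started from $Q\in\mathbb S_r^+$ at $t=0$, of $\partial_tP_t=\mathrm{Ricc}(P_t)$ and of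 $\partial_tP_t=\mathrm{Ricc}^{\pi}(P_t)$, and let $P$ and $P_{\pi}$ denote the positive definite solutions of $\mathrm{Ricc}(P)=0$ and of $\mathrm{Ricc}^{\pi}(P_{\pi})=0$. Let $E_t(Q)$ be the matrix flow with $\partial_tE_t(Q)=(A-\phi_t(Q)S)E_t(Q)$, $E_0(Q)=\mathrm{Id}$. Then $\phi_t(Q)$ and $P$ exist and are unique, and there is $\nu>0$ with the following property: for some finite nondecreasing function $\kappa$, $$\|E_t(Q)\|_2\le\kappa(\|Q\|_2)\,e^{-2\nu t}\qquad\text{for all }Q\in\mathbb S_r^+,\ t\ge0.$$ For every $\nu>0$ with this property there are $\delta\in(0,1]$, a finite constant $\chi_1(\delta)$ and a finite function $q\mapsto\chi_2(\delta,q)$ (which may also depend on the fixed data $A,C,R,\Sigma,T,\nu$) such that, for every $\epsilon\in[0,\delta]$, $\phi^{\pi_\epsilon}_t(Q)$ and $P_{\pi_\epsilon}$ exist and are unique, and for all $t\ge 0$ and $Q\in\mathbb S_r^+$ $$\|\phi^{\pi_\epsilon}_t(Q)-\phi_t(Q)\|_2\le\epsilon^2\left[\chi_1(\delta)+e^{-4t\nu}\chi_2(\delta,\|Q\|_2)\right],$$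 and, moreover, $$\|P_{\pi_\epsilon}-P\|_2\le\epsilon^2\chi_1(\delta).$$ -/

import Mathlib

open scoped Matrix Matrix.Norms.L2Operator

/-! Throughout, `‖M‖` for a real matrix `M` is the operator norm induced by the Euclidean norm. -/

namespace KalmanBucy

/-- The observability matrix, with block rows `C, C A, …, C A ^ (r - 1)`. -/
def observabilityMatrix {r r' : ℕ} (A : Matrix (Fin r) (Fin r) ℝ) (C : Matrix (Fin r') (Fin r) ℝ) :
    Matrix (Fin r × Fin r') (Fin r) ℝ :=
  Matrix.of fun i j => (C * A ^ (i.1 : ℕ)) i.2 j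

/-- The pair `(A, C)` is observable: the observability matrix has rank `r`. -/
def IsObservable {r r' : ℕ} (A : Matrix (Fin r) (Fin r) ℝ) (C : Matrix (Fin r') (Fin r) ℝ) :
    Prop :=
  (observabilityMatrix A C).rank = r

/-- The matrix `S = C' Σ⁻¹ C`. -/
noncomputable def sensorMatrix {r r' : ℕ} (C : Matrix (Fin r') (Fin r) ℝ)
    (Sigma : Matrix (Fin r') (Fin r') ℝ) : Matrix (Fin r) (Fin r) ℝ :=
  Cᵀ * Sigma⁻¹ * C

/-- The nominal Riccati drift `Ricc(Q) = A Q + Q A' - Q S Q + R`. -/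
def ricc {r : ℕ} (A R S Q : Matrix (Fin r) (Fin r) ℝ) : Matrix (Fin r) (Fin r) ℝ :=
  A * Q + Q * Aᵀ - Q * S * Q + R

/-- The Riccati drift regularised by a mapping `π`,
`Ricc^π(Q) = (A - π(Q) S) Q + Q (A - π(Q) S)' + R + π(Q) S π(Q)`. -/
def riccReg {r : ℕ} (A R S : Matrix (Fin r) (Fin r) ℝ)
    (π : Matrix (Fin r) (Fin r) ℝ → Matrix (Fin r) (Fin r) ℝ) (Q : Matrix (Fin r) (Fin r) ℝ) :
    Matrix (Fin r) (Fin r) ℝ :=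
  (A - π Q * S) * Q + Q * (A - π Q * S)ᵀ + R + π Q * S * π Q

/-- The variance inflation mapping `π_ε(Q) = Q + ε T`. -/
def inflation {r : ℕ} (T : Matrix (Fin r) (Fin r) ℝ) (ε : ℝ) (Q : Matrix (Fin r) (Fin r) ℝ) :
    Matrix (Fin r) (Fin r) ℝ :=
  Q + ε • T

/-- `p` is a solution on `[0, ∞)` of `∂ₜ p = F(p)`, `p 0 = Q`, with values in the positive
semidefinite matrices (one-sided derivative at `t = 0`). -/
def IsSolution {r : ℕ} (F : Matrix (Fin r) (Fin r) ℝ → Matrix (Fin r) (Fin r) ℝ)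
    (Q : Matrix (Fin r) (Fin r) ℝ) (p : ℝ → Matrix (Fin r) (Fin r) ℝ) : Prop :=
  p 0 = Q ∧
    ∀ t : ℝ, 0 ≤ t → (p t).PosSemidef ∧ HasDerivWithinAt p (F (p t)) (Set.Ici 0) t

/-- `φ` is the semigroup of `∂ₜ P = F(P)` on positive semidefinite matrices: from each positive
semidefinite `Q`, the path `t ↦ φ t Q` is the unique solution on `[0, ∞)`. -/
def IsFlow {r : ℕ} (F : Matrix (Fin r) (Fin r) ℝ → Matrix (Fin r) (Fin r) ℝ)
    (φ : ℝ → Matrix (Fin r) (Fin r) ℝ → Matrix (Fin r) (Fin r) ℝ) : Prop :=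
  ∀ Q : Matrix (Fin r) (Fin r) ℝ, Q.PosSemidef →
    IsSolution F Q (fun t => φ t Q) ∧
      ∀ q : ℝ → Matrix (Fin r) (Fin r) ℝ, IsSolution F Q q → ∀ t : ℝ, 0 ≤ t → q t = φ t Q

/-- `P` is the unique positive definite fixed point of `∂ₜ P = F(P)`. -/
def IsSteadyState {r : ℕ} (F : Matrix (Fin r) (Fin r) ℝ → Matrix (Fin r) (Fin r) ℝ)
    (P : Matrix (Fin r) (Fin r) ℝ) : Prop :=
  P.PosDef ∧ F P = 0 ∧ ∀ P' : Matrix (Fin r) (Fin r) ℝ, P'.PosDef → F P' = 0 → P' = P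

/-- `E` is the transition matrix of the drift `A - p_t S`:
`∂ₜ E_t = (A - p_t S) E_t`, `E_0 = Id`. -/
def IsTransition {r : ℕ} (A S : Matrix (Fin r) (Fin r) ℝ) (p E : ℝ → Matrix (Fin r) (Fin r) ℝ) :
    Prop :=
  E 0 = 1 ∧ ∀ t : ℝ, 0 ≤ t → HasDerivWithinAt E ((A - p t * S) * E t) (Set.Ici 0) t

/-- `ν > 0` is an exponential rate for the transition matrices `E_t(Q)` along the nominal flow `φ`:
`‖E_t(Q)‖ ≤ κ(‖Q‖) exp(-2 ν t)` for some finite nondecreasing function `κ`. -/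
def IsRate {r : ℕ} (A S : Matrix (Fin r) (Fin r) ℝ)
    (φ : ℝ → Matrix (Fin r) (Fin r) ℝ → Matrix (Fin r) (Fin r) ℝ) (ν : ℝ) : Prop :=
  0 < ν ∧ ∃ κ : ℝ → ℝ, Monotone κ ∧
    ∀ Q : Matrix (Fin r) (Fin r) ℝ, Q.PosSemidef →
      ∃ E : ℝ → Matrix (Fin r) (Fin r) ℝ, IsTransition A S (fun t => φ t Q) E ∧
        ∀ t : ℝ, 0 ≤ t → ‖E t‖ ≤ κ ‖Q‖ * Real.exp (-(2 * ν * t))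

end KalmanBucy

/-!
Inflating the covariance by `ε T` changes the Riccati drift only through the noise covariance: the
first-order terms cancel, and `riccReg` with `inflation T ε` is `ricc` with `R` replaced by
`R + ε² T S T` (`riccReg_inflation`). Everything thus reduces to one Riccati equation with positive
definite `R`, and to its dependence on `R`.

*Linearisation.* The Riccati equation is solved by `p = Y X⁻¹`, where `(X, Y)` solves a linear
Hamiltonian system from `(1, Q)`. The energy `vᵀ Xᵀ Y v` has derivative
`(Y v)ᵀ S (Y v) + (X v)ᵀ R (X v)`, which forces `X` to be invertible and `p` to be positive
semidefinite for all times (`exists_isSolution_isCostate`). Moreover `X⁻ᵀ` is the transition matrix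
of `A - p S`, so that no separate study of the transition matrices is needed, and
`X₁ᵀ (p₂ - p₁) X₂` is constant for two solutions of the same equation (`IsSolution.sub_eq_conj`).

*Absorption.* Comparing with controlled paths of the dual system bounds `p`
(`IsSolution.quad_le_of_control`). The uncontrolled path bounds it on `[0, 1]` in terms of `‖Q‖`;
by observability some control steers the dual path to `0` in unit time, which bounds `p` after
time `1` independently of `Q` (`exists_norm_le_of_one_le`).

*Decay.* Inside the absorbing ball `vᵀ Xᵀ p X v` grows exponentially because its derivative
dominates `vᵀ Xᵀ R X v`; hence `X⁻¹` decays exponentially (`exists_costate_rate`). Solutions then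
merge, the solution from `0` converges, and its limit is the steady state
(`exists_isSteadyState`).

*Perturbation.* For `R₂ ≥ R` the difference `D = p₂ - p` is positive semidefinite, and
`(Xᵀ D X)' = Xᵀ (R₂ - R - D S D) X` along the nominal costate `X`. Dropping the quadratic term and
integrating over `[0, 1]` and `[1, t]`, with the decay of the nominal transition matrices, gives a
bound on `D` linear in `R₂ - R` (`exists_norm_sub_le`), that is, of order `ε²`. The bound on the
steady states is its limit as `t → ∞`.
-/

namespace KalmanBucy

open Set Filter Topology

/-! ### Quadratic forms and operator norms of real matrices -/

section QuadraticForms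

lemma transpose_eq_of_posSemidef {m : Type*} {M : Matrix m m ℝ} (hM : M.PosSemidef) : Mᵀ = M := by
  simpa [Matrix.IsHermitian] using hM.isHermitian

variable {n : Type*} [Fintype n]

/-- The quadratic form `x ↦ x' M x` of a real square matrix. -/
def quad (M : Matrix n n ℝ) (x : n → ℝ) : ℝ := x ⬝ᵥ M *ᵥ x

lemma quad_add (M N : Matrix n n ℝ) (x : n → ℝ) : quad (M + N) x = quad M x + quad N x := by
  simp [quad, Matrix.add_mulVec, dotProduct_add]

lemma quad_sub (M N : Matrix n n ℝ) (x : n → ℝ) : quad (M - N) x = quad M x - quad N x := by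
  simp [quad, Matrix.sub_mulVec, dotProduct_sub]

lemma quad_smul (c : ℝ) (M : Matrix n n ℝ) (x : n → ℝ) : quad (c • M) x = c * quad M x := by
  simp [quad, Matrix.smul_mulVec, dotProduct_smul]

lemma quad_conj (M B : Matrix n n ℝ) (x : n → ℝ) : quad (Bᵀ * M * B) x = quad M (B *ᵥ x) := by
  rw [quad, quad, ← Matrix.mulVec_mulVec, ← Matrix.mulVec_mulVec, Matrix.dotProduct_mulVec,
    Matrix.vecMul_transpose]

lemma dotProduct_self_nonneg_real (x : n → ℝ) : 0 ≤ x ⬝ᵥ x := by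
  simpa using dotProduct_star_self_nonneg x

lemma quad_nonneg {M : Matrix n n ℝ} (hM : M.PosSemidef) (x : n → ℝ) : 0 ≤ quad M x := by
  simpa using! hM.dotProduct_mulVec_nonneg x

lemma posSemidef_of_quad_nonneg {M : Matrix n n ℝ} (hM : Mᵀ = M) (h : ∀ x, 0 ≤ quad M x) :
    M.PosSemidef :=
  .of_dotProduct_mulVec_nonneg (by simpa [Matrix.IsHermitian] using hM) (by simpa using! h)

lemma mulVec_eq_zero_of_quad {M : Matrix n n ℝ} (hM : M.PosSemidef) {x : n → ℝ}
    (h : quad M x = 0) : M *ᵥ x = 0 :=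
  (hM.dotProduct_mulVec_zero_iff x).1 (by simpa using! h)

lemma norm_sq_toLp (x : n → ℝ) : ‖WithLp.toLp 2 x‖ ^ 2 = x ⬝ᵥ x := by
  rw [EuclideanSpace.norm_sq_eq]; simp [dotProduct, sq]

variable [DecidableEq n]

lemma quad_one (x : n → ℝ) : quad 1 x = x ⬝ᵥ x := by simp [quad]

lemma quad_gram (B : Matrix n n ℝ) (x : n → ℝ) : quad (Bᵀ * B) x = B *ᵥ x ⬝ᵥ B *ᵥ x := by
  simpa [quad_one] using quad_conj 1 B x

lemma norm_transpose (M : Matrix n n ℝ) : ‖Mᵀ‖ = ‖M‖ := by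
  simpa using Matrix.l2_opNorm_conjTranspose M

lemma dotProduct_mulVec_self_le (M : Matrix n n ℝ) (x : n → ℝ) :
    M *ᵥ x ⬝ᵥ M *ᵥ x ≤ ‖M‖ ^ 2 * (x ⬝ᵥ x) := by
  rw [← norm_sq_toLp, ← norm_sq_toLp, ← mul_pow]
  exact pow_le_pow_left₀ (norm_nonneg _) (Matrix.l2_opNorm_mulVec M (WithLp.toLp 2 x)) 2

lemma norm_le_of_mulVec {M : Matrix n n ℝ} {c : ℝ} (hc : 0 ≤ c)
    (h : ∀ x, M *ᵥ x ⬝ᵥ M *ᵥ x ≤ c ^ 2 * (x ⬝ᵥ x)) : ‖M‖ ≤ c := by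
  rw [Matrix.cstar_norm_def]
  refine ContinuousLinearMap.opNorm_le_bound _ hc fun x => ?_
  have := h x.ofLp
  rw [← norm_sq_toLp, ← norm_sq_toLp, ← mul_pow] at this
  exact (pow_le_pow_iff_left₀ (norm_nonneg _) (by positivity) two_ne_zero).1 this

lemma abs_quad_le (M : Matrix n n ℝ) (x : n → ℝ) : |quad M x| ≤ ‖M‖ * (x ⬝ᵥ x) := by
  have h1 := abs_real_inner_le_norm (WithLp.toLp 2 (M *ᵥ x)) (WithLp.toLp 2 x)
  have h2 := Matrix.l2_opNorm_mulVec M (WithLp.toLp 2 x)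
  rw [EuclideanSpace.inner_toLp_toLp] at h1
  refine h1.trans ?_
  rw [← norm_sq_toLp, sq, ← mul_assoc]
  exact mul_le_mul_of_nonneg_right h2 (norm_nonneg _)

lemma quad_le (M : Matrix n n ℝ) (x : n → ℝ) : quad M x ≤ ‖M‖ * (x ⬝ᵥ x) :=
  (le_abs_self _).trans (abs_quad_le M x)

/-- A Gram factorisation `M = B' B` reduces the norm of `M` to its quadratic form. -/
lemma norm_le_of_quad_le {M : Matrix n n ℝ} (hM : M.PosSemidef) {c : ℝ} (hc : 0 ≤ c)
    (h : ∀ x, quad M x ≤ c * (x ⬝ᵥ x)) : ‖M‖ ≤ c := by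
  obtain ⟨B, rfl⟩ : ∃ B : Matrix n n ℝ, M = Bᴴ * B := by
    open scoped MatrixOrder in
    obtain ⟨B, hB⟩ := CStarAlgebra.nonneg_iff_eq_star_mul_self.1 (Matrix.nonneg_iff_posSemidef.2 hM)
    exact ⟨B, hB⟩
  rw [Matrix.conjTranspose_eq_transpose_of_trivial] at h
  have hB : ‖B‖ ≤ √c := norm_le_of_mulVec (Real.sqrt_nonneg c) fun x => by
    rw [← quad_gram, Real.sq_sqrt hc]; exact h x
  rw [Matrix.l2_opNorm_conjTranspose_mul_self]
  calc ‖B‖ * ‖B‖ ≤ √c * √c := by gcongr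
    _ = c := Real.mul_self_sqrt hc

lemma norm_inv_le_of_mulVec_lower {X : Matrix n n ℝ} (hX : IsUnit X) {m c : ℝ} (hc : 0 ≤ c)
    (hmc : 1 ≤ c ^ 2 * m) (h : ∀ x, m * (x ⬝ᵥ x) ≤ X *ᵥ x ⬝ᵥ X *ᵥ x) : ‖X⁻¹‖ ≤ c := by
  refine norm_le_of_mulVec hc fun x => ?_
  have h1 := h (X⁻¹ *ᵥ x)
  rw [Matrix.mulVec_mulVec, Matrix.mul_nonsing_inv _ ((Matrix.isUnit_iff_isUnit_det X).1 hX),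
    Matrix.one_mulVec] at h1
  have h0 := dotProduct_self_nonneg_real (X⁻¹ *ᵥ x)
  calc _ ≤ (c ^ 2 * m) * (X⁻¹ *ᵥ x ⬝ᵥ X⁻¹ *ᵥ x) := le_mul_of_one_le_left h0 hmc
    _ = c ^ 2 * (m * (X⁻¹ *ᵥ x ⬝ᵥ X⁻¹ *ᵥ x)) := by ring
    _ ≤ _ := by gcongr

lemma exists_quad_lower {R : Matrix n n ℝ} (hR : R.PosDef) :
    ∃ l : ℝ, 0 < l ∧ ∀ x, l * (x ⬝ᵥ x) ≤ quad R x := by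
  obtain ⟨B, hBu, rfl⟩ : ∃ B : Matrix n n ℝ, IsUnit B ∧ R = Bᵀ * B := by
    open scoped MatrixOrder in
    obtain ⟨B, hB⟩ := CStarAlgebra.nonneg_iff_eq_star_mul_self.1
      (Matrix.nonneg_iff_posSemidef.2 hR.posSemidef)
    refine ⟨B, ?_, by simpa [Matrix.star_eq_conjTranspose] using hB⟩
    exact isUnit_of_mul_isUnit_right (hB ▸ hR.isUnit)
  refine ⟨1 / (‖B⁻¹‖ ^ 2 + 1), by positivity, fun x => ?_⟩
  rw [quad_gram, div_mul_eq_mul_div, one_mul, div_le_iff₀ (by positivity)]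
  have h1 := dotProduct_mulVec_self_le B⁻¹ (B *ᵥ x)
  rw [Matrix.mulVec_mulVec, Matrix.nonsing_inv_mul _ ((Matrix.isUnit_iff_isUnit_det B).1 hBu),
    Matrix.one_mulVec] at h1
  have h0 := dotProduct_self_nonneg_real (B *ᵥ x)
  linarith

end QuadraticForms

/-! ### Differentiation of matrix paths on the half-line -/

section Calculus

variable {n : Type*} [Fintype n] [DecidableEq n]

lemma hasDerivWithinAt_transpose {F : ℝ → Matrix n n ℝ} {F' : Matrix n n ℝ} {s : Set ℝ} {t : ℝ}
    (h : HasDerivWithinAt F F' s t) : HasDerivWithinAt (fun u => (F u)ᵀ) F'ᵀ s t :=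
  ((Matrix.transposeLinearEquiv n n ℝ ℝ).toLinearMap.toContinuousLinearMap.hasFDerivAt
    (x := F t)).comp_hasDerivWithinAt t h

lemma hasDerivWithinAt_quad {F : ℝ → Matrix n n ℝ} {F' : Matrix n n ℝ} {s : Set ℝ} {t : ℝ}
    (h : HasDerivWithinAt F F' s t) (x : n → ℝ) :
    HasDerivWithinAt (fun u => quad (F u) x) (quad F' x) s t := by
  let q : Matrix n n ℝ →ₗ[ℝ] ℝ :=
    { toFun := fun M => quad M x
      map_add' := fun M N => quad_add M N x
      map_smul' := fun c M => quad_smul c M x }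
  exact (q.toContinuousLinearMap.hasFDerivAt (x := F t)).comp_hasDerivWithinAt t h

lemma hasDerivWithinAt_inv {F : ℝ → Matrix n n ℝ} {F' : Matrix n n ℝ} {s : Set ℝ} {t : ℝ}
    (h : HasDerivWithinAt F F' s t) (hu : IsUnit (F t)) :
    HasDerivWithinAt (fun u => (F u)⁻¹) (-((F t)⁻¹ * F' * (F t)⁻¹)) s t := by
  obtain ⟨u, hu⟩ := hu
  have h1 := hasFDerivAt_ringInverse (𝕜 := ℝ) u
  rw [hu] at h1
  have h2 := h1.comp_hasDerivWithinAt t h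
  have h3 : ((u⁻¹ : (Matrix n n ℝ)ˣ) : Matrix n n ℝ) = (F t)⁻¹ := by
    rw [← hu, Matrix.coe_units_inv]
  simpa [Function.comp_def, ← Matrix.nonsing_inv_eq_ringInverse, h3] using! h2

lemma shift_hasDerivWithinAt {E : Type*} [NormedAddCommGroup E] [NormedSpace ℝ E]
    {f : ℝ → E} {f' : E} {s t : ℝ} (hs : 0 ≤ s)
    (h : HasDerivWithinAt f f' (Ici 0) (s + t)) :
    HasDerivWithinAt (fun u => f (s + u)) f' (Ici 0) t := by
  have h1 : HasDerivWithinAt (fun u : ℝ => s + u) 1 (Ici 0) t :=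
    (hasDerivAt_id t).hasDerivWithinAt.const_add s
  have := HasDerivWithinAt.scomp t h h1 fun u (hu : 0 ≤ u) => add_nonneg hs hu
  simpa [Function.comp_def] using this

lemma eq_initial_of_deriv_zero {E : Type*} [NormedAddCommGroup E] [NormedSpace ℝ E]
    {f : ℝ → E} (h : ∀ t, 0 ≤ t → HasDerivWithinAt f 0 (Ici 0) t) {t : ℝ} (ht : 0 ≤ t) :
    f t = f 0 := by
  have := norm_image_sub_le_of_norm_deriv_right_le_segment (f := f) (f' := fun _ => 0) (C := 0)
    (fun s hs => ((h s hs.1).continuousWithinAt).mono Icc_subset_Ici_self)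
    (fun s hs => (h s hs.1).mono (Ici_subset_Ici.2 hs.1)) (by simp) t ⟨ht, le_rfl⟩
  simpa [sub_eq_zero] using this

/-- Integration of an inequality between derivatives. -/
lemma sub_le_sub_of_deriv_le {f f' g g' : ℝ → ℝ} {a b : ℝ} (ha : 0 ≤ a) (hab : a ≤ b)
    (hf : ∀ t ∈ Icc a b, HasDerivWithinAt f (f' t) (Ici 0) t)
    (hg : ∀ t ∈ Icc a b, HasDerivWithinAt g (g' t) (Ici 0) t)
    (h : ∀ t ∈ Icc a b, f' t ≤ g' t) : f b - f a ≤ g b - g a := by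
  have hs : Icc a b ⊆ Ici 0 := fun t ht => ha.trans ht.1
  have key := image_le_of_deriv_right_le_deriv_boundary (f := f) (f' := f') (a := a) (b := b)
    (fun t ht => (hf t ht).continuousWithinAt.mono hs)
    (fun t ht => (hf t (Ico_subset_Icc_self ht)).mono (Ici_subset_Ici.2 (ha.trans ht.1)))
    (B := fun t => g t + (f a - g a)) (B' := g') (by simp)
    (fun t ht => ((hg t ht).continuousWithinAt.mono hs).add continuousWithinAt_const)
    (fun t ht => ((hg t (Ico_subset_Icc_self ht)).mono
      (Ici_subset_Ici.2 (ha.trans ht.1))).add_const _)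
    (fun t ht => h t (Ico_subset_Icc_self ht)) ⟨hab, le_rfl⟩
  linarith

lemma le_of_deriv_nonneg {f f' : ℝ → ℝ} {a b : ℝ} (ha : 0 ≤ a) (hab : a ≤ b)
    (hf : ∀ t ∈ Icc a b, HasDerivWithinAt f (f' t) (Ici 0) t)
    (h : ∀ t ∈ Icc a b, 0 ≤ f' t) : f a ≤ f b := by
  have := sub_le_sub_of_deriv_le ha hab (f := fun _ => 0) (f' := fun _ => 0)
    (fun t _ => hasDerivWithinAt_const t _ _) hf h
  linarith

lemma exists_linear_flow {E : Type*} [NormedAddCommGroup E] [NormedSpace ℝ E] [CompleteSpace E]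
    (H : E →L[ℝ] E) (z : E) : ∃ Z : ℝ → E, Z 0 = z ∧ ∀ t, HasDerivAt Z (H (Z t)) t := by
  refine ⟨fun t => NormedSpace.exp (t • H) z, by simp, fun t => ?_⟩
  simpa using (hasDerivAt_exp_smul_const' (𝕂 := ℝ) H t).clm_apply (hasDerivAt_const t z)

end Calculus

/-! ### The Hamiltonian linear system -/

variable {r : ℕ} {A R R₁ R₂ S Q Q₁ Q₂ : Matrix (Fin r) (Fin r) ℝ}

/-- `(X, Y)` solves on `[0, ∞)` the linear system `X' = -Aᵀ X + S Y`, `Y' = R X + A Y`; where `X`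
is invertible, `Y X⁻¹` solves the Riccati equation. -/
structure IsHamiltonianPath (A R S : Matrix (Fin r) (Fin r) ℝ)
    (X Y : ℝ → Matrix (Fin r) (Fin r) ℝ) : Prop where
  deriv_fst : ∀ t, 0 ≤ t → HasDerivWithinAt X (-Aᵀ * X t + S * Y t) (Ici 0) t
  deriv_snd : ∀ t, 0 ≤ t → HasDerivWithinAt Y (R * X t + A * Y t) (Ici 0) t

lemma exists_isHamiltonianPath (A R S X₀ Y₀ : Matrix (Fin r) (Fin r) ℝ) :
    ∃ X Y, IsHamiltonianPath A R S X Y ∧ X 0 = X₀ ∧ Y 0 = Y₀ := by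
  let M := Matrix (Fin r) (Fin r) ℝ
  let H : (M × M) →L[ℝ] (M × M) :=
    ((-(ContinuousLinearMap.mul ℝ M Aᵀ)).comp (ContinuousLinearMap.fst ℝ M M) +
      (ContinuousLinearMap.mul ℝ M S).comp (ContinuousLinearMap.snd ℝ M M)).prod
    ((ContinuousLinearMap.mul ℝ M R).comp (ContinuousLinearMap.fst ℝ M M) +
      (ContinuousLinearMap.mul ℝ M A).comp (ContinuousLinearMap.snd ℝ M M))
  obtain ⟨Z, hZ0, hZ⟩ := exists_linear_flow H (X₀, Y₀)
  refine ⟨fun t => (Z t).1, fun t => (Z t).2, ⟨fun t _ => ?_, fun t _ => ?_⟩, by simp [hZ0],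
    by simp [hZ0]⟩
  · have := (hZ t).hasFDerivAt.fst.hasDerivAt.hasDerivWithinAt (s := Ici 0)
    simpa [H] using this
  · have := (hZ t).hasFDerivAt.snd.hasDerivAt.hasDerivWithinAt (s := Ici 0)
    simpa [H] using this

namespace IsHamiltonianPath

variable {X Y : ℝ → Matrix (Fin r) (Fin r) ℝ}

lemma deriv_energy (h : IsHamiltonianPath A R S X Y) (hS : Sᵀ = S) {t : ℝ} (ht : 0 ≤ t) :
    HasDerivWithinAt (fun u => (X u)ᵀ * Y u) ((Y t)ᵀ * S * Y t + (X t)ᵀ * R * X t) (Ici 0) t := by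
  refine ((hasDerivWithinAt_transpose (h.deriv_fst t ht)).mul (h.deriv_snd t ht)).congr_deriv ?_
  simp only [Matrix.transpose_add, Matrix.transpose_mul, Matrix.transpose_neg,
    Matrix.transpose_transpose, hS]
  noncomm_ring

lemma transpose_energy (h : IsHamiltonianPath A R S X Y) (hR : Rᵀ = R) (hS : Sᵀ = S)
    (h0 : ((X 0)ᵀ * Y 0)ᵀ = (X 0)ᵀ * Y 0) {t : ℝ} (ht : 0 ≤ t) :
    ((X t)ᵀ * Y t)ᵀ = (X t)ᵀ * Y t := by
  have := eq_initial_of_deriv_zero (f := fun u => ((X u)ᵀ * Y u)ᵀ - (X u)ᵀ * Y u) (fun u hu => by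
    refine ((hasDerivWithinAt_transpose (h.deriv_energy hS hu)).sub
      (h.deriv_energy hS hu)).congr_deriv ?_
    simp only [Matrix.transpose_add, Matrix.transpose_mul, Matrix.transpose_transpose, hS, hR]
    noncomm_ring) ht
  simpa [h0, sub_eq_zero] using this

lemma deriv_quad_energy (h : IsHamiltonianPath A R S X Y) (hS : Sᵀ = S) (v : Fin r → ℝ) {t : ℝ}
    (ht : 0 ≤ t) : HasDerivWithinAt (fun u => quad ((X u)ᵀ * Y u) v)
      (quad S (Y t *ᵥ v) + quad R (X t *ᵥ v)) (Ici 0) t := by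
  rw [← quad_conj, ← quad_conj, ← quad_add]
  exact hasDerivWithinAt_quad (h.deriv_energy hS ht) v

lemma quad_energy_mono (h : IsHamiltonianPath A R S X Y) (hR : R.PosSemidef) (hS : S.PosSemidef)
    (v : Fin r → ℝ) {s t : ℝ} (hs : 0 ≤ s) (hst : s ≤ t) :
    quad ((X s)ᵀ * Y s) v ≤ quad ((X t)ᵀ * Y t) v :=
  le_of_deriv_nonneg hs hst
    (fun _ hu => h.deriv_quad_energy (transpose_eq_of_posSemidef hS) v (hs.trans hu.1))
    fun _ _ => add_nonneg (quad_nonneg hS _) (quad_nonneg hR _)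

/-- The energy `vᵀ Xᵀ Y v` is nondecreasing, and it vanishes where `X v` does; so both of its
sources vanish up to that time. -/
lemma sources_eq_zero (h : IsHamiltonianPath A R S X Y) (hR : R.PosSemidef) (hS : S.PosSemidef)
    (h0 : ((X 0)ᵀ * Y 0).PosSemidef) {t : ℝ} {v : Fin r → ℝ} (hv : X t *ᵥ v = 0)
    {s : ℝ} (hs : s ∈ Ico 0 t) : quad S (Y s *ᵥ v) = 0 ∧ quad R (X s *ᵥ v) = 0 := by
  have ht : 0 < t := hs.1.trans_lt hs.2
  have hvt : quad ((X t)ᵀ * Y t) v = 0 := by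
    rw [quad, ← Matrix.mulVec_mulVec, Matrix.dotProduct_mulVec, Matrix.vecMul_transpose, hv,
      zero_dotProduct]
  have hz : ∀ u ∈ Icc 0 t, quad ((X u)ᵀ * Y u) v = 0 := fun u hu =>
    le_antisymm (hvt ▸ h.quad_energy_mono hR hS v hu.1 hu.2)
      ((quad_nonneg h0 v).trans (h.quad_energy_mono hR hS v le_rfl hu.1))
  have hsI : s ∈ Icc 0 t := ⟨hs.1, hs.2.le⟩
  have h1 := (h.deriv_quad_energy (transpose_eq_of_posSemidef hS) v hs.1).mono
    (Icc_subset_Ici_self : Icc 0 t ⊆ Ici 0)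
  have h2 : HasDerivWithinAt (fun u => quad ((X u)ᵀ * Y u) v) 0 (Icc 0 t) s :=
    (hasDerivWithinAt_const s _ (0 : ℝ)).congr hz (hz s hsI)
  have h3 := (uniqueDiffOn_Icc ht s hsI).eq_deriv _ h1 h2
  have h4 := quad_nonneg hS (Y s *ᵥ v)
  have h5 := quad_nonneg hR (X s *ᵥ v)
  constructor <;> linarith

lemma isUnit_fst (h : IsHamiltonianPath A R S X Y) (hR : R.PosDef) (hS : S.PosSemidef)
    (hX : X 0 = 1) (hY : (Y 0).PosSemidef) {t : ℝ} (ht : 0 ≤ t) : IsUnit (X t) := by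
  rcases ht.eq_or_lt with rfl | ht'
  · simp [hX]
  rw [← Matrix.mulVec_injective_iff_isUnit]
  refine (injective_iff_map_eq_zero (Matrix.mulVecLin (X t))).2 fun v hv => ?_
  have h0 := (h.sources_eq_zero hR.posSemidef hS (by simpa [hX] using hY) hv ⟨le_rfl, ht'⟩).2
  rw [hX, Matrix.one_mulVec] at h0
  by_contra hne
  have := hR.dotProduct_mulVec_pos hne
  simp only [star_trivial] at this
  exact this.ne' h0

end IsHamiltonianPath

/-! ### Solutions of the Riccati equation -/

/-- `X` is the costate matrix along the path `p`: it is invertible and solves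
`X' = -(A - p S)ᵀ X`, `X 0 = 1`. Its inverse transpose is the transition matrix of `A - p S`. -/
structure IsCostate (A S : Matrix (Fin r) (Fin r) ℝ) (p X : ℝ → Matrix (Fin r) (Fin r) ℝ) :
    Prop where
  initial : X 0 = 1
  deriv : ∀ t, 0 ≤ t → HasDerivWithinAt X (-(A - p t * S)ᵀ * X t) (Ici 0) t
  isUnit : ∀ t, 0 ≤ t → IsUnit (X t)

lemma mul_inv_of_isUnit {X : Matrix (Fin r) (Fin r) ℝ} (h : IsUnit X) : X * X⁻¹ = 1 :=
  Matrix.mul_nonsing_inv _ ((Matrix.isUnit_iff_isUnit_det X).1 h)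

lemma inv_mul_of_isUnit {X : Matrix (Fin r) (Fin r) ℝ} (h : IsUnit X) : X⁻¹ * X = 1 :=
  Matrix.nonsing_inv_mul _ ((Matrix.isUnit_iff_isUnit_det X).1 h)

lemma IsSolution.transpose_eq {F : Matrix (Fin r) (Fin r) ℝ → Matrix (Fin r) (Fin r) ℝ}
    {p : ℝ → Matrix (Fin r) (Fin r) ℝ} (h : IsSolution F Q p) {t : ℝ} (ht : 0 ≤ t) :
    (p t)ᵀ = p t :=
  transpose_eq_of_posSemidef (h.2 t ht).1

lemma IsSolution.continuousOn {F : Matrix (Fin r) (Fin r) ℝ → Matrix (Fin r) (Fin r) ℝ}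
    {p : ℝ → Matrix (Fin r) (Fin r) ℝ} (h : IsSolution F Q p) : ContinuousOn p (Ici 0) :=
  fun t ht => (h.2 t ht).2.continuousWithinAt

lemma IsSolution.shift {F : Matrix (Fin r) (Fin r) ℝ → Matrix (Fin r) (Fin r) ℝ}
    {p : ℝ → Matrix (Fin r) (Fin r) ℝ} (h : IsSolution F Q p) {s : ℝ} (hs : 0 ≤ s) :
    IsSolution F (p s) (fun t => p (s + t)) :=
  ⟨by simp, fun t ht => ⟨(h.2 _ (add_nonneg hs ht)).1,
    shift_hasDerivWithinAt hs (h.2 _ (add_nonneg hs ht)).2⟩⟩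

/-- The first component of the Hamiltonian path started from `(1, Q)` is invertible, because the
energy `vᵀ Xᵀ Y v` starts nonnegative and has the positive source `vᵀ Xᵀ R X v`. -/
theorem exists_isSolution_isCostate (hR : R.PosDef) (hS : S.PosSemidef) (hQ : Q.PosSemidef) :
    ∃ p X, IsSolution (ricc A R S) Q p ∧ IsCostate A S p X := by
  obtain ⟨X, Y, h, hX, hY⟩ := exists_isHamiltonianPath A R S 1 Q
  have hu : ∀ t, 0 ≤ t → IsUnit (X t) := fun t ht => h.isUnit_fst hR hS hX (hY ▸ hQ) ht
  have hps : ∀ t, 0 ≤ t → (Y t * (X t)⁻¹).PosSemidef := fun t ht => by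
    have hE : ((X t)ᵀ * Y t).PosSemidef := by
      refine posSemidef_of_quad_nonneg (h.transpose_energy (transpose_eq_of_posSemidef
        hR.posSemidef) (transpose_eq_of_posSemidef hS) ?_ ht) fun v => ?_
      · simp [hX, hY, transpose_eq_of_posSemidef hQ]
      · refine le_trans ?_ (h.quad_energy_mono hR.posSemidef hS v le_rfl ht)
        simpa [hX, hY] using quad_nonneg hQ v
    have := hE.conjTranspose_mul_mul_same (X t)⁻¹
    rwa [Matrix.conjTranspose_eq_transpose_of_trivial, ← Matrix.mul_assoc, ← Matrix.transpose_mul,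
      mul_inv_of_isUnit (hu t ht), Matrix.transpose_one, Matrix.one_mul] at this
  refine ⟨fun t => Y t * (X t)⁻¹, X, ⟨by simp [hX, hY], fun t ht => ⟨hps t ht, ?_⟩⟩, hX,
    fun t ht => ?_, hu⟩
  · refine ((h.deriv_snd t ht).mul (hasDerivWithinAt_inv (h.deriv_fst t ht)
      (hu t ht))).congr_deriv ?_
    have h1 := mul_inv_of_isUnit (hu t ht)
    calc _ = R * (X t * (X t)⁻¹) + A * (Y t * (X t)⁻¹) + Y t * (X t)⁻¹ * Aᵀ * (X t * (X t)⁻¹)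
          - Y t * (X t)⁻¹ * S * (Y t * (X t)⁻¹) := by noncomm_ring
      _ = _ := by rw [h1, ricc]; noncomm_ring
  · refine (h.deriv_fst t ht).congr_deriv ?_
    rw [Matrix.transpose_sub, Matrix.transpose_mul, transpose_eq_of_posSemidef (hps t ht),
      transpose_eq_of_posSemidef hS]
    calc _ = -Aᵀ * X t + S * (Y t * ((X t)⁻¹ * X t)) := by
          rw [inv_mul_of_isUnit (hu t ht), Matrix.mul_one]
      _ = _ := by noncomm_ring

lemma ricc_sub_ricc (hS : Sᵀ = S) (p₁ p₂ : Matrix (Fin r) (Fin r) ℝ) (h₂ : p₂ᵀ = p₂) :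
    ricc A R₂ S p₂ - ricc A R₁ S p₁ =
      (A - p₁ * S) * (p₂ - p₁) + (p₂ - p₁) * (A - p₂ * S)ᵀ + (R₂ - R₁) := by
  rw [Matrix.transpose_sub, Matrix.transpose_mul, h₂, hS, ricc, ricc]
  noncomm_ring

lemma exists_norm_le_of_continuousOn {E : Type*} [NormedAddCommGroup E] {f : ℝ → E} (t : ℝ)
    (hf : ContinuousOn f (Ici 0)) : ∃ K, 0 ≤ K ∧ ∀ s ∈ Icc 0 t, ‖f s‖ ≤ K := by
  obtain ⟨K, hK⟩ := isCompact_Icc.exists_bound_of_continuousOn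
    (hf.mono (Icc_subset_Ici_self : Icc 0 t ⊆ Ici 0))
  exact ⟨max K 0, le_max_right _ _, fun s hs => (hK s hs).trans (le_max_left _ _)⟩

theorem IsSolution.unique (hS : S.PosSemidef) {p q : ℝ → Matrix (Fin r) (Fin r) ℝ}
    (hp : IsSolution (ricc A R S) Q p) (hq : IsSolution (ricc A R S) Q q) {t : ℝ} (ht : 0 ≤ t) :
    q t = p t := by
  have hS' := transpose_eq_of_posSemidef hS
  have hc : ∀ {f : ℝ → Matrix (Fin r) (Fin r) ℝ}, IsSolution (ricc A R S) Q f →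
      ContinuousOn (fun s => A - f s * S) (Ici 0) := fun hf =>
    continuousOn_const.sub (hf.continuousOn.mul continuousOn_const)
  obtain ⟨K₁, hK₁, h₁⟩ := exists_norm_le_of_continuousOn t (hc hp)
  obtain ⟨K₂, hK₂, h₂⟩ := exists_norm_le_of_continuousOn t (hc hq)
  refine sub_eq_zero.1 (eq_zero_of_abs_deriv_le_mul_abs_self_of_eq_zero_right
    (f := fun s => q s - p s) (f' := fun s => ricc A R S (q s) - ricc A R S (p s))
    (K := K₁ + K₂) (a := 0) (b := t) ?_ ?_ ?_ ?_ t ⟨ht, le_rfl⟩)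
  · exact (hq.continuousOn.sub hp.continuousOn).mono Icc_subset_Ici_self
  · exact fun s hs => ((hq.2 s hs.1).2.sub (hp.2 s hs.1).2).mono (Ici_subset_Ici.2 hs.1)
  · simp [hp.1, hq.1]
  · intro s hs
    have hsI := Ico_subset_Icc_self hs
    rw [ricc_sub_ricc hS' _ _ (hq.transpose_eq hs.1), sub_self, add_zero]
    calc _ ≤ ‖A - p s * S‖ * ‖q s - p s‖ + ‖q s - p s‖ * ‖(A - q s * S)ᵀ‖ :=
          (norm_add_le _ _).trans (add_le_add (norm_mul_le _ _) (norm_mul_le _ _))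
      _ ≤ K₁ * ‖q s - p s‖ + ‖q s - p s‖ * K₂ := by
          rw [norm_transpose]; gcongr; exacts [h₁ s hsI, h₂ s hsI]
      _ = _ := by ring

lemma IsSolution.exists_isCostate (hR : R.PosDef) (hS : S.PosSemidef) (hQ : Q.PosSemidef)
    {p : ℝ → Matrix (Fin r) (Fin r) ℝ} (hp : IsSolution (ricc A R S) Q p) :
    ∃ X, IsCostate A S p X := by
  obtain ⟨q, X, hq, hX⟩ := exists_isSolution_isCostate (A := A) hR hS hQ
  exact ⟨X, hX.initial, fun t ht => hp.unique hS hq ht ▸ hX.deriv t ht, hX.isUnit⟩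

namespace IsCostate

variable {p p₁ p₂ X X₁ X₂ : ℝ → Matrix (Fin r) (Fin r) ℝ}

lemma continuousOn (h : IsCostate A S p X) : ContinuousOn X (Ici 0) :=
  fun t ht => (h.deriv t ht).continuousWithinAt

lemma shift (h : IsCostate A S p X) {s : ℝ} (hs : 0 ≤ s) :
    IsCostate A S (fun t => p (s + t)) (fun t => X (s + t) * (X s)⁻¹) where
  initial := by simpa using mul_inv_of_isUnit (h.isUnit s hs)
  deriv t ht := by
    refine ((shift_hasDerivWithinAt hs (h.deriv _ (add_nonneg hs ht))).mul_const
      ((X s)⁻¹)).congr_deriv ?_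
    rw [Matrix.mul_assoc]
  isUnit t ht := (h.isUnit _ (add_nonneg hs ht)).mul
    (Matrix.isUnit_nonsing_inv_iff.2 (h.isUnit s hs))

/-- Conjugation by costates removes the drift terms. -/
lemma deriv_conj (h₁ : IsCostate A S p₁ X₁) (h₂ : IsCostate A S p₂ X₂)
    {D : ℝ → Matrix (Fin r) (Fin r) ℝ} {D' : Matrix (Fin r) (Fin r) ℝ} {t : ℝ} (ht : 0 ≤ t)
    (hD : HasDerivWithinAt D D' (Ici 0) t) :
    HasDerivWithinAt (fun u => (X₁ u)ᵀ * D u * X₂ u)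
      ((X₁ t)ᵀ * (D' - (A - p₁ t * S) * D t - D t * (A - p₂ t * S)ᵀ) * X₂ t) (Ici 0) t := by
  refine (((hasDerivWithinAt_transpose (h₁.deriv t ht)).mul hD).mul
    (h₂.deriv t ht)).congr_deriv ?_
  simp only [Pi.mul_apply, Matrix.transpose_mul, Matrix.transpose_neg, Matrix.transpose_transpose]
  noncomm_ring

lemma isTransition (h : IsCostate A S p X) : IsTransition A S p (fun t => (X t)⁻¹ᵀ) := by
  refine ⟨by simp [h.initial], fun t ht => ?_⟩
  refine (hasDerivWithinAt_transpose (hasDerivWithinAt_inv (h.deriv t ht)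
    (h.isUnit t ht))).congr_deriv ?_
  rw [Matrix.mul_assoc, Matrix.mul_assoc, mul_inv_of_isUnit (h.isUnit t ht), Matrix.mul_one]
  simp only [Matrix.transpose_mul, Matrix.transpose_neg, Matrix.transpose_transpose]
  noncomm_ring

lemma eq_transition (h : IsCostate A S p X) {E : ℝ → Matrix (Fin r) (Fin r) ℝ}
    (hE : IsTransition A S p E) {t : ℝ} (ht : 0 ≤ t) : E t = (X t)⁻¹ᵀ := by
  have key := eq_initial_of_deriv_zero (f := fun u => (X u)ᵀ * E u) (fun u hu => by
    refine ((hasDerivWithinAt_transpose (h.deriv u hu)).mul (hE.2 u hu)).congr_deriv ?_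
    simp only [Matrix.transpose_mul, Matrix.transpose_neg, Matrix.transpose_transpose]
    noncomm_ring) ht
  simp only [h.initial, hE.1, Matrix.transpose_one, Matrix.mul_one] at key
  have h1 : (X t)⁻¹ᵀ * (X t)ᵀ = 1 := by
    rw [← Matrix.transpose_mul, mul_inv_of_isUnit (h.isUnit t ht), Matrix.transpose_one]
  calc E t = (X t)⁻¹ᵀ * ((X t)ᵀ * E t) := by rw [← Matrix.mul_assoc, h1, Matrix.one_mul]
    _ = _ := by rw [key, Matrix.mul_one]

end IsCostate

/-- Two solutions with the same data differ by a congruence of their initial difference. -/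
lemma IsSolution.sub_eq_conj (hS : S.PosSemidef) {p₁ p₂ X₁ X₂ : ℝ → Matrix (Fin r) (Fin r) ℝ}
    (h₁ : IsSolution (ricc A R S) Q₁ p₁) (h₂ : IsSolution (ricc A R S) Q₂ p₂)
    (hX₁ : IsCostate A S p₁ X₁) (hX₂ : IsCostate A S p₂ X₂) {t : ℝ} (ht : 0 ≤ t) :
    p₂ t - p₁ t = (X₁ t)⁻¹ᵀ * (Q₂ - Q₁) * (X₂ t)⁻¹ := by
  have key := eq_initial_of_deriv_zero (f := fun u => (X₁ u)ᵀ * (p₂ u - p₁ u) * X₂ u)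
    (fun u hu => by
      refine (hX₁.deriv_conj hX₂ hu ((h₂.2 u hu).2.sub (h₁.2 u hu).2)).congr_deriv ?_
      rw [ricc_sub_ricc (transpose_eq_of_posSemidef hS) _ _ (h₂.transpose_eq hu)]
      simp) ht
  simp only [hX₁.initial, hX₂.initial, h₁.1, h₂.1, Matrix.transpose_one, Matrix.mul_one,
    Matrix.one_mul] at key
  have h1 : (X₁ t)⁻¹ᵀ * (X₁ t)ᵀ = 1 := by
    rw [← Matrix.transpose_mul, mul_inv_of_isUnit (hX₁.isUnit t ht), Matrix.transpose_one]
  calc p₂ t - p₁ t = ((X₁ t)⁻¹ᵀ * (X₁ t)ᵀ) * (p₂ t - p₁ t) * (X₂ t * (X₂ t)⁻¹) := by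
        rw [h1, mul_inv_of_isUnit (hX₂.isUnit t ht), Matrix.one_mul, Matrix.mul_one]
    _ = (X₁ t)⁻¹ᵀ * ((X₁ t)ᵀ * (p₂ t - p₁ t) * X₂ t) * (X₂ t)⁻¹ := by simp only [Matrix.mul_assoc]
    _ = _ := by rw [key]

/-! ### Bounds on the Riccati flow from the dual control problem -/

/-- Along a controlled path `y' = -Aᵀ y + S w`, completing the square in `w - p y` bounds the
Riccati quadratic form by the running cost `wᵀ S w + yᵀ R y`. -/
lemma IsSolution.quad_le_of_control (hS : S.PosSemidef)
    {p y w : ℝ → Matrix (Fin r) (Fin r) ℝ} (hp : IsSolution (ricc A R S) Q p)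
    (hy : ∀ t, 0 ≤ t → HasDerivWithinAt y (-Aᵀ * y t + S * w t) (Ici 0) t)
    {t K : ℝ} (ht : 0 ≤ t) (v : Fin r → ℝ)
    (hK : ∀ s ∈ Icc 0 t, quad S (w s *ᵥ v) + quad R (y s *ᵥ v) ≤ K) :
    quad (p t) (y t *ᵥ v) ≤ quad Q (y 0 *ᵥ v) + K * t := by
  have hS' := transpose_eq_of_posSemidef hS
  have hd : ∀ s ∈ Icc 0 t, HasDerivWithinAt (fun u => quad ((y u)ᵀ * p u * y u) v)
      (quad S (w s *ᵥ v) + quad R (y s *ᵥ v) - quad S ((w s - p s * y s) *ᵥ v)) (Ici 0) s := by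
    intro s hs
    rw [← quad_conj, ← quad_conj, ← quad_conj, ← quad_add, ← quad_sub]
    refine (hasDerivWithinAt_quad (((hasDerivWithinAt_transpose (hy s hs.1)).mul
      (hp.2 s hs.1).2).mul (hy s hs.1)) v).congr_deriv ?_
    congr 1
    simp only [Pi.mul_apply, Matrix.transpose_mul, Matrix.transpose_neg, Matrix.transpose_add,
      Matrix.transpose_sub, Matrix.transpose_transpose, hS', hp.transpose_eq hs.1, ricc]
    noncomm_ring
  have := sub_le_sub_of_deriv_le le_rfl ht hd (g := fun u => K * u) (g' := fun _ => K)
    (fun s _ => by simpa using ((hasDerivAt_id s).const_mul K).hasDerivWithinAt)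
    (fun s hs => by have := hK s hs; have := quad_nonneg hS ((w s - p s * y s) *ᵥ v); linarith)
  simp only [quad_conj, hp.1] at this
  linarith

lemma quad_mulVec_le (M B : Matrix (Fin r) (Fin r) ℝ) {b : ℝ} (hB : ‖B‖ ≤ b) (v : Fin r → ℝ) :
    quad M (B *ᵥ v) ≤ ‖M‖ * b ^ 2 * (v ⬝ᵥ v) := by
  have h0 := dotProduct_self_nonneg_real v
  calc _ ≤ ‖M‖ * (B *ᵥ v ⬝ᵥ B *ᵥ v) := quad_le _ _
    _ ≤ ‖M‖ * (‖B‖ ^ 2 * (v ⬝ᵥ v)) := by gcongr; exact dotProduct_mulVec_self_le _ _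
    _ ≤ ‖M‖ * (b ^ 2 * (v ⬝ᵥ v)) := by gcongr
    _ = _ := by ring

/-- The norm of a Riccati solution is bounded through an invertible controlled path. -/
lemma IsSolution.norm_le_of_control (hS : S.PosSemidef)
    {p y w : ℝ → Matrix (Fin r) (Fin r) ℝ} (hp : IsSolution (ricc A R S) Q p)
    (hy : ∀ t, 0 ≤ t → HasDerivWithinAt y (-Aᵀ * y t + S * w t) (Ici 0) t)
    {t a b c d : ℝ} (ht : 0 ≤ t) (ht1 : t ≤ 1) (hyt : IsUnit (y t)) (hc : ‖(y t)⁻¹‖ ≤ c)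
    (hd : ‖y 0‖ ≤ d) (ha : ∀ s ∈ Icc 0 t, ‖w s‖ ≤ a) (hb : ∀ s ∈ Icc 0 t, ‖y s‖ ≤ b) :
    ‖p t‖ ≤ (‖Q‖ * d ^ 2 + (‖S‖ * a ^ 2 + ‖R‖ * b ^ 2)) * c ^ 2 := by
  refine norm_le_of_quad_le (hp.2 t ht).1 (by positivity) fun x => ?_
  set v := (y t)⁻¹ *ᵥ x with hv
  have hx : y t *ᵥ v = x := by
    rw [hv, Matrix.mulVec_mulVec, mul_inv_of_isUnit hyt, Matrix.one_mulVec]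
  have hv0 := dotProduct_self_nonneg_real v
  have hvx : v ⬝ᵥ v ≤ c ^ 2 * (x ⬝ᵥ x) := by
    have h0 := dotProduct_self_nonneg_real x
    refine (dotProduct_mulVec_self_le _ _).trans ?_
    gcongr
  have h1 := hp.quad_le_of_control hS hy ht v
    (K := (‖S‖ * a ^ 2 + ‖R‖ * b ^ 2) * (v ⬝ᵥ v)) fun s hs => by
      have := quad_mulVec_le S (w s) (ha s hs) v
      have := quad_mulVec_le R (y s) (hb s hs) v
      linarith
  have h2 := quad_mulVec_le Q (y 0) hd v
  rw [hx] at h1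
  calc quad (p t) x ≤ ‖Q‖ * d ^ 2 * (v ⬝ᵥ v) + (‖S‖ * a ^ 2 + ‖R‖ * b ^ 2) * (v ⬝ᵥ v) * 1 := by
        refine h1.trans (add_le_add h2 ?_)
        gcongr
    _ = (‖Q‖ * d ^ 2 + (‖S‖ * a ^ 2 + ‖R‖ * b ^ 2)) * (v ⬝ᵥ v) := by ring
    _ ≤ (‖Q‖ * d ^ 2 + (‖S‖ * a ^ 2 + ‖R‖ * b ^ 2)) * (c ^ 2 * (x ⬝ᵥ x)) := by gcongr
    _ = _ := by ring

/-- The uncontrolled path (`w = 0`) bounds the flow on the unit time interval, affinely in the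
norm of the initial state. -/
theorem exists_norm_le_of_le_one (A R : Matrix (Fin r) (Fin r) ℝ) (hS : S.PosSemidef) :
    ∃ b₁ b₀ : ℝ, 0 ≤ b₁ ∧ 0 ≤ b₀ ∧ ∀ Q p, IsSolution (ricc A R S) Q p →
      ∀ t ∈ Icc (0 : ℝ) 1, ‖p t‖ ≤ b₁ * ‖Q‖ + b₀ := by
  -- With `S = 0` the first component solves `X' = -Aᵀ X`; the second one, with source term `1`,
  -- serves only to show that `X` is invertible.
  obtain ⟨X, Y, h, hX, hY⟩ := exists_isHamiltonianPath A 1 0 (1 : Matrix (Fin r) (Fin r) ℝ) 0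
  have hu : ∀ t, 0 ≤ t → IsUnit (X t) := fun t ht =>
    h.isUnit_fst Matrix.PosDef.one .zero hX (hY ▸ .zero) ht
  obtain ⟨b, hb0, hb⟩ := exists_norm_le_of_continuousOn 1
    fun t ht => (h.deriv_fst t ht).continuousWithinAt
  obtain ⟨c, hc0, hc⟩ := exists_norm_le_of_continuousOn 1 fun t ht =>
    (hasDerivWithinAt_inv (h.deriv_fst t ht) (hu t ht)).continuousWithinAt
  refine ⟨b ^ 2 * c ^ 2, ‖R‖ * b ^ 2 * c ^ 2, by positivity, by positivity,
    fun Q p hp t ht => ?_⟩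
  have := hp.norm_le_of_control (w := fun _ => 0) hS
    (fun t ht => (h.deriv_fst t ht).congr_deriv (by simp)) ht.1 ht.2 (hu t ht.1) (hc t ht)
    (hb 0 (by simp)) (a := 0) (by simp) (fun s hs => hb s ⟨hs.1, hs.2.trans ht.2⟩)
  exact this.trans_eq (by ring)

/-- The unobservable subspace of the pair `(A, S)` is trivial. -/
def TrivialUnobservable (A S : Matrix (Fin r) (Fin r) ℝ) : Prop :=
  ∀ v, (∀ k : ℕ, (S * A ^ k) *ᵥ v = 0) → v = 0

lemma IsObservable.trivialUnobservable {r' : ℕ} {C : Matrix (Fin r') (Fin r) ℝ}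
    {Sigma : Matrix (Fin r') (Fin r') ℝ} (h : IsObservable A C) (hSigma : Sigma.PosDef) :
    TrivialUnobservable A (sensorMatrix C Sigma) := by
  intro v hv
  have hC : ∀ k : ℕ, C *ᵥ (A ^ k *ᵥ v) = 0 := fun k => by
    have h1 := hv k
    rw [← Matrix.mulVec_mulVec] at h1
    set u := A ^ k *ᵥ v
    by_contra hne
    have h2 := hSigma.inv.dotProduct_mulVec_pos hne
    have h3 : u ⬝ᵥ sensorMatrix C Sigma *ᵥ u = C *ᵥ u ⬝ᵥ Sigma⁻¹ *ᵥ C *ᵥ u := by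
      rw [sensorMatrix, ← Matrix.mulVec_mulVec, ← Matrix.mulVec_mulVec, Matrix.dotProduct_mulVec,
        Matrix.vecMul_transpose]
    rw [h1, dotProduct_zero] at h3
    simp only [star_trivial] at h2
    linarith
  have hker : (observabilityMatrix A C).mulVecLin v = 0 := by
    ext i
    have := congrFun (hC i.1) i.2
    rw [Matrix.mulVec_mulVec] at this
    exact this
  have hrank : Module.finrank ℝ (LinearMap.range (observabilityMatrix A C).mulVecLin) = r := h
  have h1 := LinearMap.finrank_range_add_finrank_ker (observabilityMatrix A C).mulVecLin
  rw [hrank, Module.finrank_fin_fun] at h1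
  have h2 : LinearMap.ker (observabilityMatrix A C).mulVecLin = ⊥ :=
    Submodule.finrank_eq_zero.1 (by omega)
  exact (Submodule.mem_bot ℝ).1 (h2 ▸ hker)

lemma hasDerivWithinAt_mulVec {F : ℝ → Matrix (Fin r) (Fin r) ℝ} {F' : Matrix (Fin r) (Fin r) ℝ}
    {s : Set ℝ} {t : ℝ} (h : HasDerivWithinAt F F' s t) (v : Fin r → ℝ) :
    HasDerivWithinAt (fun u => F u *ᵥ v) (F' *ᵥ v) s t := by
  let q : Matrix (Fin r) (Fin r) ℝ →ₗ[ℝ] (Fin r → ℝ) :=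
    { toFun := fun M => M *ᵥ v
      map_add' := fun M N => Matrix.add_mulVec M N v
      map_smul' := fun c M => Matrix.smul_mulVec c M v }
  exact (q.toContinuousLinearMap.hasFDerivAt (x := F t)).comp_hasDerivWithinAt t h

/-- Controllability of the dual system: the optimal control for the cost `wᵀ S w` steers `0` to
any state in unit time. -/
lemma IsHamiltonianPath.isUnit_fst_one (hS : S.PosSemidef) (hobs : TrivialUnobservable A S)
    {X Y : ℝ → Matrix (Fin r) (Fin r) ℝ} (h : IsHamiltonianPath A 0 S X Y) (hX : X 0 = 0)
    (hY : Y 0 = 1) : IsUnit (X 1) := by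
  rw [← Matrix.mulVec_injective_iff_isUnit]
  refine (injective_iff_map_eq_zero (Matrix.mulVecLin (X 1))).2 fun v hv => ?_
  have hpow : ∀ k : ℕ, ∀ s ∈ Ioo (0 : ℝ) 1, (S * A ^ k * Y s) *ᵥ v = 0 := by
    intro k
    induction k with
    | zero =>
      intro s hs
      have := (h.sources_eq_zero .zero hS (by simpa [hX] using .zero) hv
        (Ioo_subset_Ico_self hs)).1
      simpa [Matrix.mulVec_mulVec] using mulVec_eq_zero_of_quad hS this
    | succ k ih =>
      intro s hs
      have h1 := (hasDerivWithinAt_mulVec ((h.deriv_snd s hs.1.le).const_mul (S * A ^ k)) v).mono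
        (fun u (hu : u ∈ Ioo (0 : ℝ) 1) => hu.1.le)
      have h2 : HasDerivWithinAt (fun u => (S * A ^ k * Y u) *ᵥ v) 0 (Ioo 0 1) s :=
        (hasDerivWithinAt_const s _ (0 : Fin r → ℝ)).congr ih (ih s hs)
      have h3 := (isOpen_Ioo.uniqueDiffOn s hs).eq_deriv _ h1 h2
      rw [← h3, pow_succ]
      congr 1
      noncomm_ring
  have hYv : Y (1 / 2) *ᵥ v = 0 := hobs _ fun k => by
    rw [Matrix.mulVec_mulVec]
    exact hpow k _ ⟨by norm_num, by norm_num⟩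
  -- `Y` solves `Y' = A Y`, and the transpose of the dual path below is a left inverse of it.
  obtain ⟨Z, _, hZ, hZ0, -⟩ := exists_isHamiltonianPath A 0 0 (1 : Matrix (Fin r) (Fin r) ℝ) 0
  have key := eq_initial_of_deriv_zero (f := fun u => (Z u)ᵀ * Y u) (fun u hu => by
    refine ((hasDerivWithinAt_transpose (hZ.deriv_fst u hu)).mul
      (h.deriv_snd u hu)).congr_deriv ?_
    simp only [Matrix.transpose_add, Matrix.transpose_mul, Matrix.transpose_neg,
      Matrix.transpose_transpose]
    simp [Matrix.mul_assoc]) (t := 1 / 2) (by norm_num)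
  simp only [hZ0, hY, Matrix.transpose_one, Matrix.mul_one] at key
  rw [← Matrix.one_mulVec v, ← key, ← Matrix.mulVec_mulVec, hYv, Matrix.mulVec_zero]

/-- Observability bounds the flow after unit time, uniformly in the initial state. -/
theorem exists_norm_le_of_one_le (R : Matrix (Fin r) (Fin r) ℝ) (hS : S.PosSemidef)
    (hobs : TrivialUnobservable A S) :
    ∃ B : ℝ, 0 < B ∧ ∀ Q p, IsSolution (ricc A R S) Q p → ∀ t : ℝ, 1 ≤ t → ‖p t‖ ≤ B := by
  -- `X` is a dual path with control `Y`; it starts from `0`, so the initial state drops out.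
  obtain ⟨X, Y, h, hX, hY⟩ := exists_isHamiltonianPath A 0 S 0 1
  have hu := h.isUnit_fst_one hS hobs hX hY
  obtain ⟨b, hb0, hb⟩ := exists_norm_le_of_continuousOn 1
    fun t ht => (h.deriv_fst t ht).continuousWithinAt
  obtain ⟨a, ha0, ha⟩ := exists_norm_le_of_continuousOn 1
    fun t ht => (h.deriv_snd t ht).continuousWithinAt
  refine ⟨(‖S‖ * a ^ 2 + ‖R‖ * b ^ 2) * ‖(X 1)⁻¹‖ ^ 2 + 1, by positivity,
    fun Q p hp t ht => ?_⟩
  have := (hp.shift (sub_nonneg.2 ht)).norm_le_of_control hS h.deriv_fst zero_le_one le_rfl hu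
    le_rfl (d := 0) (by simp [hX]) ha hb
  rw [sub_add_cancel] at this
  exact this.trans (by simp)

/-! ### Exponential decay of the transition matrices -/

lemma mul_exp_le_of_deriv {f f' : ℝ → ℝ} {a b c : ℝ} (ha : 0 ≤ a) (hab : a ≤ b)
    (hf : ∀ t ∈ Icc a b, HasDerivWithinAt f (f' t) (Ici 0) t)
    (h : ∀ t ∈ Icc a b, c * f t ≤ f' t) : f a * Real.exp (c * (b - a)) ≤ f b := by
  have hexp : ∀ t, HasDerivAt (fun t => Real.exp (-(c * t))) (Real.exp (-(c * t)) * -c) t :=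
    fun t => by simpa using ((hasDerivAt_id t).const_mul c).neg.exp
  have key := le_of_deriv_nonneg ha hab
    (fun t ht => (hf t ht).mul (hexp t).hasDerivWithinAt) fun t ht => by
      have := mul_nonneg (sub_nonneg.2 (h t ht)) (Real.exp_pos (-(c * t))).le
      linarith
  simp only [Pi.mul_apply] at key
  calc f a * Real.exp (c * (b - a)) = f a * Real.exp (-(c * a)) * Real.exp (c * b) := by
        rw [mul_assoc, ← Real.exp_add]; ring_nf
    _ ≤ f b * Real.exp (-(c * b)) * Real.exp (c * b) := by gcongr
    _ = f b := by rw [mul_assoc, ← Real.exp_add]; simp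

lemma IsCostate.lower_of_norm_le {p X : ℝ → Matrix (Fin r) (Fin r) ℝ} (hX : IsCostate A S p X)
    {t m : ℝ} (ht : 0 ≤ t) (hm : ∀ s ∈ Icc 0 t, ‖A - p s * S‖ ≤ m) (v : Fin r → ℝ) :
    v ⬝ᵥ v * Real.exp (-(2 * m) * t) ≤ X t *ᵥ v ⬝ᵥ X t *ᵥ v := by
  have := mul_exp_le_of_deriv (c := -(2 * m)) le_rfl ht
    (f := fun s => quad ((X s)ᵀ * 1 * X s) v) (fun s hs =>
      hasDerivWithinAt_quad (hX.deriv_conj hX hs.1 (hasDerivWithinAt_const s _ 1)) v)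
    (fun s hs => by
      rw [quad_conj, quad_conj, quad_one, Matrix.mul_one, Matrix.one_mul, quad_sub, quad_sub]
      have h1 := (quad_le (A - p s * S) (X s *ᵥ v))
      have h2 := (abs_le.1 (abs_quad_le (A - p s * S)ᵀ (X s *ᵥ v))).2
      have h3 : quad 0 (X s *ᵥ v) = 0 := by simp [quad]
      rw [norm_transpose] at h2
      have h4 := mul_le_mul_of_nonneg_right (hm s hs) (dotProduct_self_nonneg_real (X s *ᵥ v))
      linarith)
  simpa [quad_gram, quad_one, hX.initial] using this

lemma IsSolution.deriv_costate_energy (hS : S.PosSemidef) {p X : ℝ → Matrix (Fin r) (Fin r) ℝ}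
    (hp : IsSolution (ricc A R S) Q p) (hX : IsCostate A S p X) (v : Fin r → ℝ) {t : ℝ}
    (ht : 0 ≤ t) : HasDerivWithinAt (fun u => quad (p u) (X u *ᵥ v))
      (quad R (X t *ᵥ v) + quad S ((p t * X t) *ᵥ v)) (Ici 0) t := by
  simp only [← quad_conj]
  rw [← quad_add]
  refine (hasDerivWithinAt_quad (hX.deriv_conj hX ht (hp.2 t ht).2) v).congr_deriv ?_
  congr 1
  simp only [ricc, Matrix.transpose_sub, Matrix.transpose_mul, hp.transpose_eq ht,
    transpose_eq_of_posSemidef hS]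
  noncomm_ring

/-- The energy `vᵀ Xᵀ p X v` is the Lyapunov function: its derivative dominates `|X v|²`, which
dominates the energy itself once the flow has entered the absorbing ball. On the unit time interval
`|X v|²` cannot shrink by more than a factor that depends on the norm of the initial state. -/
theorem exists_costate_rate (hR : R.PosDef) (hS : S.PosSemidef) (hobs : TrivialUnobservable A S) :
    ∃ ν : ℝ, 0 < ν ∧ ∃ κ : ℝ → ℝ, Monotone κ ∧ ∀ Q p X, IsSolution (ricc A R S) Q p →
      IsCostate A S p X → ∀ t, 0 ≤ t → ‖(X t)⁻¹‖ ≤ κ ‖Q‖ * Real.exp (-(2 * ν * t)) := by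
  obtain ⟨b₁, b₀, hb₁, hb₀, hb⟩ := exists_norm_le_of_le_one A R hS
  obtain ⟨B, hB0, hB⟩ := exists_norm_le_of_one_le R hS hobs
  obtain ⟨l, hl, hRl⟩ := exists_quad_lower hR
  -- `c` is the growth rate of the energy in the absorbing ball, and `m q` bounds the drift on
  -- `[0, 1]`.
  let c := l / B
  have hc : 0 < c := by positivity
  let d := min 1 c
  have hd : 0 < d := lt_min one_pos hc
  let m : ℝ → ℝ := fun q => ‖A‖ + (b₁ * q + b₀) * ‖S‖
  refine ⟨c / 4, by positivity, fun q => (√d)⁻¹ * Real.exp (m q + c / 2), ?_, ?_⟩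
  · intro q q' hq
    dsimp only [m]
    gcongr
  intro Q p X hp hX t ht
  have hm : ∀ s ∈ Icc (0 : ℝ) 1, ‖A - p s * S‖ ≤ m ‖Q‖ := fun s hs =>
    (norm_sub_le _ _).trans (add_le_add le_rfl ((norm_mul_le _ _).trans
      (mul_le_mul_of_nonneg_right (hb Q p hp s hs) (norm_nonneg _))))
  have hm0 : 0 ≤ m ‖Q‖ := (norm_nonneg _).trans (hm 0 (by simp))
  have hshort : ∀ v, ∀ s ∈ Icc (0 : ℝ) 1,
      v ⬝ᵥ v * Real.exp (-(2 * m ‖Q‖)) ≤ X s *ᵥ v ⬝ᵥ X s *ᵥ v := fun v s hs => by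
    refine le_trans ?_ (hX.lower_of_norm_le hs.1
      (fun u hu => hm u ⟨hu.1, hu.2.trans hs.2⟩) v)
    have := dotProduct_self_nonneg_real v
    gcongr
    nlinarith [hs.2]
  have hlower : ∀ v, d * Real.exp (-(2 * m ‖Q‖) - c + c * t) * (v ⬝ᵥ v) ≤
      X t *ᵥ v ⬝ᵥ X t *ᵥ v := by
    intro v
    have hv := dotProduct_self_nonneg_real v
    rcases le_total t 1 with h1 | h1
    · refine le_trans ?_ (hshort v t ⟨ht, h1⟩)
      rw [mul_comm]
      have h2 : Real.exp (-(2 * m ‖Q‖) - c + c * t) ≤ Real.exp (-(2 * m ‖Q‖)) :=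
        Real.exp_le_exp.2 (by nlinarith)
      gcongr
      calc _ ≤ 1 * Real.exp (-(2 * m ‖Q‖)) := by gcongr; exact min_le_left _ _
        _ = _ := one_mul _
    · have hg1 : l * (v ⬝ᵥ v * Real.exp (-(2 * m ‖Q‖))) ≤ quad (p 1) (X 1 *ᵥ v) := by
        have h2 := sub_le_sub_of_deriv_le le_rfl zero_le_one
          (f := fun s => l * (v ⬝ᵥ v * Real.exp (-(2 * m ‖Q‖))) * s)
          (f' := fun _ => l * (v ⬝ᵥ v * Real.exp (-(2 * m ‖Q‖))))
          (fun s _ => by simpa using ((hasDerivAt_id s).const_mul _).hasDerivWithinAt)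
          (fun s hs => hp.deriv_costate_energy hS hX v hs.1) fun s hs => by
            have h3 := hRl (X s *ᵥ v)
            have h4 := quad_nonneg hS ((p s * X s) *ᵥ v)
            have h5 := mul_le_mul_of_nonneg_left (hshort v s hs) hl.le
            linarith
        have h3 := quad_nonneg (hp.2 0 le_rfl).1 (X 0 *ᵥ v)
        linarith
      have hg := mul_exp_le_of_deriv (c := c) zero_le_one h1
        (fun s hs => hp.deriv_costate_energy hS hX v (zero_le_one.trans hs.1)) fun s hs => by
          have h2 : quad (p s) (X s *ᵥ v) ≤ B * (X s *ᵥ v ⬝ᵥ X s *ᵥ v) :=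
            (quad_le _ _).trans (mul_le_mul_of_nonneg_right (hB Q p hp s hs.1)
              (dotProduct_self_nonneg_real _))
          have h3 := hRl (X s *ᵥ v)
          have h4 := quad_nonneg hS ((p s * X s) *ᵥ v)
          have h5 : c * (B * (X s *ᵥ v ⬝ᵥ X s *ᵥ v)) = l * (X s *ᵥ v ⬝ᵥ X s *ᵥ v) := by
            rw [← mul_assoc, div_mul_cancel₀ _ hB0.ne']
          have h6 := mul_le_mul_of_nonneg_left h2 hc.le
          linarith
      have hgt : quad (p t) (X t *ᵥ v) ≤ B * (X t *ᵥ v ⬝ᵥ X t *ᵥ v) :=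
        (quad_le _ _).trans (mul_le_mul_of_nonneg_right (hB Q p hp t h1)
          (dotProduct_self_nonneg_real _))
      have h2 : c * (v ⬝ᵥ v * Real.exp (-(2 * m ‖Q‖))) * Real.exp (c * (t - 1)) ≤
          X t *ᵥ v ⬝ᵥ X t *ᵥ v := by
        refine le_of_mul_le_mul_left ?_ hB0
        calc _ = l * (v ⬝ᵥ v * Real.exp (-(2 * m ‖Q‖))) * Real.exp (c * (t - 1)) := by
              dsimp only [c]; field_simp
          _ ≤ quad (p 1) (X 1 *ᵥ v) * Real.exp (c * (t - 1)) := by gcongr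
          _ ≤ _ := hg.trans hgt
      refine le_trans ?_ h2
      have h3 : Real.exp (-(2 * m ‖Q‖) - c + c * t) =
          Real.exp (-(2 * m ‖Q‖)) * Real.exp (c * (t - 1)) := by
        rw [← Real.exp_add]; ring_nf
      rw [h3]
      calc _ ≤ c * (Real.exp (-(2 * m ‖Q‖)) * Real.exp (c * (t - 1))) * (v ⬝ᵥ v) := by
            gcongr; exact min_le_right _ _
        _ = _ := by ring
  refine norm_inv_le_of_mulVec_lower (hX.isUnit t ht) (by positivity) (le_of_eq ?_) hlower
  have hsq : ((√d)⁻¹) ^ 2 = d⁻¹ := by rw [inv_pow, Real.sq_sqrt hd.le]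
  have hexp : Real.exp (m ‖Q‖ + c / 2) ^ 2 * Real.exp (-(2 * (c / 4) * t)) ^ 2 *
      Real.exp (-(2 * m ‖Q‖) - c + c * t) = 1 := by
    rw [← Real.exp_nat_mul, ← Real.exp_nat_mul, ← Real.exp_add, ← Real.exp_add, Real.exp_eq_one_iff]
    push_cast
    ring
  calc (1 : ℝ) = d⁻¹ * d * (Real.exp (m ‖Q‖ + c / 2) ^ 2 * Real.exp (-(2 * (c / 4) * t)) ^ 2 *
      Real.exp (-(2 * m ‖Q‖) - c + c * t)) := by rw [hexp, inv_mul_cancel₀ hd.ne', one_mul]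
    _ = _ := by rw [← hsq]; ring

/-! ### The flow and its steady state -/

lemma exists_isFlow (A : Matrix (Fin r) (Fin r) ℝ) (hR : R.PosDef) (hS : S.PosSemidef) :
    ∃ φ, IsFlow (ricc A R S) φ := by
  have h : ∀ Q : Matrix (Fin r) (Fin r) ℝ, ∃ p, Q.PosSemidef → IsSolution (ricc A R S) Q p := by
    intro Q
    by_cases hQ : Q.PosSemidef
    · obtain ⟨p, X, hp, -⟩ := exists_isSolution_isCostate (A := A) hR hS hQ
      exact ⟨p, fun _ => hp⟩
    · exact ⟨0, fun h => absurd h hQ⟩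
  choose p hp using h
  exact ⟨fun t Q => p Q t, fun Q hQ => ⟨hp Q hQ, fun q hq t ht => (hp Q hQ).unique hS hq ht⟩⟩

/-- `κ` and `ν` bound the inverse costates along all Riccati solutions. -/
def IsCostateRate (A R S : Matrix (Fin r) (Fin r) ℝ) (ν : ℝ) (κ : ℝ → ℝ) : Prop :=
  ∀ Q p X, IsSolution (ricc A R S) Q p → IsCostate A S p X →
    ∀ t, 0 ≤ t → ‖(X t)⁻¹‖ ≤ κ ‖Q‖ * Real.exp (-(2 * ν * t))

lemma IsSolution.posSemidef {F : Matrix (Fin r) (Fin r) ℝ → Matrix (Fin r) (Fin r) ℝ}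
    {p : ℝ → Matrix (Fin r) (Fin r) ℝ} (h : IsSolution F Q p) : Q.PosSemidef :=
  h.1 ▸ (h.2 0 le_rfl).1

lemma IsCostateRate.nonneg {ν : ℝ} {κ : ℝ → ℝ} (hκ : IsCostateRate A R S ν κ) (hR : R.PosDef)
    (hS : S.PosSemidef) (hQ : Q.PosSemidef) : 0 ≤ κ ‖Q‖ := by
  obtain ⟨p, X, hp, hX⟩ := exists_isSolution_isCostate (A := A) hR hS hQ
  simpa using (norm_nonneg _).trans (hκ Q p X hp hX 0 le_rfl)

lemma IsCostateRate.norm_sub_le {ν : ℝ} {κ : ℝ → ℝ} (hκ : IsCostateRate A R S ν κ)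
    (hR : R.PosDef) (hS : S.PosSemidef) {p₁ p₂ : ℝ → Matrix (Fin r) (Fin r) ℝ}
    (h₁ : IsSolution (ricc A R S) Q₁ p₁) (h₂ : IsSolution (ricc A R S) Q₂ p₂) {t : ℝ}
    (ht : 0 ≤ t) :
    ‖p₂ t - p₁ t‖ ≤ κ ‖Q₁‖ * κ ‖Q₂‖ * ‖Q₂ - Q₁‖ * Real.exp (-(4 * ν * t)) := by
  obtain ⟨X₁, hX₁⟩ := h₁.exists_isCostate hR hS h₁.posSemidef
  obtain ⟨X₂, hX₂⟩ := h₂.exists_isCostate hR hS h₂.posSemidef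
  have e₁ := hκ _ _ _ h₁ hX₁ t ht
  have e₂ := hκ _ _ _ h₂ hX₂ t ht
  have k₁ := hκ.nonneg hR hS h₁.posSemidef
  rw [h₁.sub_eq_conj hS h₂ hX₁ hX₂ ht]
  calc _ ≤ ‖(X₁ t)⁻¹ᵀ‖ * ‖Q₂ - Q₁‖ * ‖(X₂ t)⁻¹‖ :=
        (norm_mul_le _ _).trans (mul_le_mul_of_nonneg_right (norm_mul_le _ _) (norm_nonneg _))
    _ ≤ (κ ‖Q₁‖ * Real.exp (-(2 * ν * t))) * ‖Q₂ - Q₁‖ * (κ ‖Q₂‖ * Real.exp (-(2 * ν * t))) := by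
        rw [norm_transpose]; gcongr
    _ = κ ‖Q₁‖ * κ ‖Q₂‖ * ‖Q₂ - Q₁‖ * (Real.exp (-(2 * ν * t)) * Real.exp (-(2 * ν * t))) := by
        ring
    _ = _ := by rw [← Real.exp_add]; ring_nf

lemma tendsto_const_mul_exp_neg (K : ℝ) {a : ℝ} (ha : 0 < a) :
    Tendsto (fun t : ℝ => K * Real.exp (-(a * t))) atTop (𝓝 0) := by
  simpa using (Real.tendsto_exp_atBot.comp
    (tendsto_neg_atTop_atBot.comp (tendsto_id.const_mul_atTop ha))).const_mul K

/-- Any two solutions of the same Riccati equation merge. -/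
lemma IsCostateRate.tendsto_sub {ν : ℝ} {κ : ℝ → ℝ} (hκ : IsCostateRate A R S ν κ) (hν : 0 < ν)
    (hR : R.PosDef) (hS : S.PosSemidef) {p₁ p₂ : ℝ → Matrix (Fin r) (Fin r) ℝ}
    (h₁ : IsSolution (ricc A R S) Q₁ p₁) (h₂ : IsSolution (ricc A R S) Q₂ p₂) :
    Tendsto (fun t => p₂ t - p₁ t) atTop (𝓝 0) := by
  refine squeeze_zero_norm' ?_ (tendsto_const_mul_exp_neg (κ ‖Q₁‖ * κ ‖Q₂‖ * ‖Q₂ - Q₁‖)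
    (by positivity : 0 < 4 * ν))
  filter_upwards [eventually_ge_atTop 0] with t ht using hκ.norm_sub_le hR hS h₁ h₂ ht

lemma posSemidef_of_tendsto {p : ℝ → Matrix (Fin r) (Fin r) ℝ} {P : Matrix (Fin r) (Fin r) ℝ}
    (h : Tendsto p atTop (𝓝 P)) (hp : ∀ t, 0 ≤ t → (p t).PosSemidef) : P.PosSemidef := by
  refine posSemidef_of_quad_nonneg ?_ fun x => ?_
  · have h1 := ((continuous_id.matrix_transpose).tendsto P).comp h
    refine tendsto_nhds_unique (h1.congr' ?_) h
    filter_upwards [eventually_ge_atTop 0] with t ht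
    exact transpose_eq_of_posSemidef (hp t ht)
  · have hc : Continuous fun M : Matrix (Fin r) (Fin r) ℝ => quad M x :=
      continuous_const.dotProduct (continuous_id.matrix_mulVec continuous_const)
    refine ge_of_tendsto ((hc.tendsto P).comp h) ?_
    filter_upwards [eventually_ge_atTop 0] with t ht using quad_nonneg (hp t ht) x

lemma continuous_ricc (A R S : Matrix (Fin r) (Fin r) ℝ) : Continuous (ricc A R S) := by
  unfold ricc
  fun_prop

/-- The limit of a solution is a zero of the drift. -/
lemma IsSolution.eq_zero_of_tendsto {F : Matrix (Fin r) (Fin r) ℝ → Matrix (Fin r) (Fin r) ℝ}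
    (hF : Continuous F) {p : ℝ → Matrix (Fin r) (Fin r) ℝ} {P : Matrix (Fin r) (Fin r) ℝ}
    (hp : IsSolution F Q p) (h : Tendsto p atTop (𝓝 P)) : F P = 0 := by
  have hstep : Tendsto (fun t => p (t + 1) - p t) atTop (𝓝 (F P)) := by
    rw [Metric.tendsto_atTop]
    intro ε hε
    obtain ⟨N, hN⟩ := (Metric.tendsto_atTop.1 ((hF.tendsto P).comp h)) (ε / 2) (by positivity)
    refine ⟨max N 0, fun t ht => ?_⟩
    have ht0 : 0 ≤ t := (le_max_right _ _).trans ht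
    have hd : ∀ s ∈ Icc t (t + 1), HasDerivWithinAt (fun u => p u - u • F P)
        (F (p s) - F P) (Ici 0) s := fun s hs => by
      exact ((hp.2 s (ht0.trans hs.1)).2.sub
        ((hasDerivAt_id s).smul_const (F P)).hasDerivWithinAt).congr_deriv (by simp)
    have key := norm_image_sub_le_of_norm_deriv_right_le_segment
      (fun s hs => ((hd s hs).continuousWithinAt).mono fun u hu => ht0.trans hu.1)
      (fun s hs => (hd s (Ico_subset_Icc_self hs)).mono (Ici_subset_Ici.2 (ht0.trans hs.1)))
      (C := ε / 2) (fun s hs => by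
        have := hN s ((le_max_left _ _).trans (ht.trans hs.1))
        rw [dist_eq_norm] at this
        exact this.le) (t + 1) ⟨by linarith, le_rfl⟩
    rw [dist_eq_norm]
    calc _ = ‖p (t + 1) - (t + 1) • F P - (p t - t • F P)‖ := by
          congr 1; rw [add_smul, one_smul]; abel
      _ ≤ ε / 2 * (t + 1 - t) := key
      _ < ε := by linarith
  have h0 : Tendsto (fun t => p (t + 1) - p t) atTop (𝓝 (P - P)) :=
    (h.comp (tendsto_atTop_add_const_right _ _ tendsto_id)).sub h
  rw [sub_self] at h0
  exact tendsto_nhds_unique hstep h0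

lemma posDef_of_ricc_eq_zero (hR : R.PosDef) {P : Matrix (Fin r) (Fin r) ℝ} (hP : P.PosSemidef)
    (h : ricc A R S P = 0) : P.PosDef := by
  refine .of_dotProduct_mulVec_pos hP.isHermitian fun x hx => ?_
  rw [star_trivial]
  refine lt_of_le_of_ne (quad_nonneg hP x) fun h0 => ?_
  have hPx := mulVec_eq_zero_of_quad hP h0.symm
  have hxP : x ᵥ* P = 0 := by
    rw [← transpose_eq_of_posSemidef hP, Matrix.vecMul_transpose, hPx]
  have h1 : quad (ricc A R S P) x = quad R x := by
    simp [quad, ricc, Matrix.add_mulVec, Matrix.sub_mulVec, ← Matrix.mulVec_mulVec, hPx,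
      Matrix.dotProduct_mulVec x P, hxP]
  have h2 := hR.dotProduct_mulVec_pos hx
  rw [star_trivial] at h2
  rw [h] at h1
  have h3 : quad 0 x = 0 := by simp [quad]
  exact h2.ne (h3.symm.trans h1)

lemma isSolution_const {F : Matrix (Fin r) (Fin r) ℝ → Matrix (Fin r) (Fin r) ℝ}
    {P : Matrix (Fin r) (Fin r) ℝ} (hP : P.PosSemidef) (h : F P = 0) :
    IsSolution F P (fun _ => P) :=
  ⟨rfl, fun t _ => ⟨hP, by rw [h]; exact hasDerivWithinAt_const t _ P⟩⟩

/-- Exponential merging makes the solution started from `0` a Cauchy path. -/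
theorem exists_isSteadyState (hR : R.PosDef) (hS : S.PosSemidef) (hobs : TrivialUnobservable A S) :
    ∃ P, IsSteadyState (ricc A R S) P := by
  obtain ⟨ν, hν, κ, hmono, hκ : IsCostateRate A R S ν κ⟩ := exists_costate_rate hR hS hobs
  obtain ⟨b₁, b₀, -, hb₀, hb⟩ := exists_norm_le_of_le_one A R hS
  obtain ⟨B, hB0, hB⟩ := exists_norm_le_of_one_le R hS hobs
  obtain ⟨p, -, hp, -⟩ := exists_isSolution_isCostate (A := A) hR hS (Q := 0) .zero
  have hbd : ∀ s, 0 ≤ s → ‖p s‖ ≤ b₀ + B := fun s hs => by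
    rcases le_total s 1 with h1 | h1
    · have := hb 0 p hp s ⟨hs, h1⟩
      simp only [norm_zero, mul_zero, zero_add] at this
      linarith
    · linarith [hB 0 p hp s h1]
  have hk0 := hκ.nonneg hR hS .zero
  have hcauchy : ∀ t s, 0 ≤ t → 0 ≤ s →
      ‖p (t + s) - p t‖ ≤ κ ‖(0 : Matrix (Fin r) (Fin r) ℝ)‖ * κ (b₀ + B) * (b₀ + B) *
        Real.exp (-(4 * ν * t)) := fun t s ht hs => by
    have := hκ.norm_sub_le hR hS hp (hp.shift hs) ht
    rw [add_comm s t, sub_zero] at this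
    refine this.trans ?_
    have h1 := hmono (hbd s hs)
    have h2 := hκ.nonneg hR hS (hp.2 s hs).1
    have := hbd s hs
    gcongr
    exact mul_nonneg hk0 (h2.trans h1)
  set K := κ ‖(0 : Matrix (Fin r) (Fin r) ℝ)‖ * κ (b₀ + B) * (b₀ + B)
  have hlim := tendsto_const_mul_exp_neg K (by positivity : 0 < 4 * ν)
  have hseq : CauchySeq fun n : ℕ => p n := by
    refine cauchySeq_of_le_tendsto_0' (fun n : ℕ => K * Real.exp (-(4 * ν * n))) (fun n m hnm => ?_)
      (hlim.comp tendsto_natCast_atTop_atTop)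
    have := hcauchy n (m - n) n.cast_nonneg (sub_nonneg.2 (by exact_mod_cast hnm))
    rwa [add_sub_cancel, ← dist_eq_norm, dist_comm] at this
  obtain ⟨P, hP⟩ := cauchySeq_tendsto_of_complete hseq
  have htend : Tendsto p atTop (𝓝 P) := by
    rw [← tendsto_sub_nhds_zero_iff]
    refine squeeze_zero_norm' ?_ hlim
    filter_upwards [eventually_ge_atTop 0] with t ht
    refine le_of_tendsto ((tendsto_const_nhds (x := p t)).sub hP).norm ?_
    filter_upwards [tendsto_natCast_atTop_atTop.eventually_ge_atTop t] with n hn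
    have := hcauchy t (n - t) ht (sub_nonneg.2 hn)
    rwa [add_sub_cancel, norm_sub_rev] at this
  have hPs := posSemidef_of_tendsto htend fun t ht => (hp.2 t ht).1
  have hP0 := hp.eq_zero_of_tendsto (continuous_ricc A R S) htend
  refine ⟨P, posDef_of_ricc_eq_zero hR hPs hP0, hP0, fun P' hP' h' => ?_⟩
  have := hκ.tendsto_sub hν hR hS (isSolution_const hPs hP0) (isSolution_const hP'.posSemidef h')
  exact sub_eq_zero.1 (tendsto_nhds_unique tendsto_const_nhds this)

/-! ### Perturbation of the noise covariance -/

/-- The flow is monotone in the noise covariance. -/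
lemma IsSolution.sub_posSemidef (hR₂ : R₂.PosDef) (hS : S.PosSemidef)
    (hG : (R₂ - R₁).PosSemidef) {p₁ p₂ : ℝ → Matrix (Fin r) (Fin r) ℝ}
    (h₁ : IsSolution (ricc A R₁ S) Q p₁) (h₂ : IsSolution (ricc A R₂ S) Q p₂) {t : ℝ}
    (ht : 0 ≤ t) : (p₂ t - p₁ t).PosSemidef := by
  obtain ⟨X, hX⟩ := h₂.exists_isCostate hR₂ hS h₂.posSemidef
  have hS' := transpose_eq_of_posSemidef hS
  refine posSemidef_of_quad_nonneg
    (by rw [Matrix.transpose_sub, h₁.transpose_eq ht, h₂.transpose_eq ht]) fun x => ?_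
  have key := le_of_deriv_nonneg le_rfl ht
    (f := fun s => quad ((X s)ᵀ * (p₂ s - p₁ s) * X s) ((X t)⁻¹ *ᵥ x)) (fun s hs =>
      hasDerivWithinAt_quad
        (hX.deriv_conj hX hs.1 ((h₂.2 s hs.1).2.sub (h₁.2 s hs.1).2)) _) fun s hs => by
      have h3 : ricc A R₂ S (p₂ s) - ricc A R₁ S (p₁ s) - (A - p₂ s * S) * (p₂ s - p₁ s) -
          (p₂ s - p₁ s) * (A - p₂ s * S)ᵀ =
          (R₂ - R₁) + (p₂ s - p₁ s)ᵀ * S * (p₂ s - p₁ s) := by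
        rw [ricc_sub_ricc hS' _ _ (h₂.transpose_eq hs.1), Matrix.transpose_sub (p₂ s),
          h₁.transpose_eq hs.1, h₂.transpose_eq hs.1]
        noncomm_ring
      rw [Pi.sub_apply, h3, quad_conj, quad_add, quad_conj]
      exact add_nonneg (quad_nonneg hG _) (quad_nonneg hS _)
  simp only [quad_conj, h₁.1, h₂.1, sub_self, Matrix.mulVec_mulVec,
    mul_inv_of_isUnit (hX.isUnit t ht), Matrix.one_mulVec] at key
  simpa [quad] using key

/-- The effect at time `t` of perturbing the noise covariance on `[a, b]`, in terms of the
transition matrices of the nominal flow alone. -/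
lemma IsSolution.quad_sub_le (hS : S.PosSemidef) {ν : ℝ} {κ : ℝ → ℝ}
    (hν : 0 < ν) (hκ : IsCostateRate A R₁ S ν κ) (hR₁ : R₁.PosDef)
    {p₁ p₂ X : ℝ → Matrix (Fin r) (Fin r) ℝ}
    (h₁ : IsSolution (ricc A R₁ S) Q p₁) (h₂ : IsSolution (ricc A R₂ S) Q p₂)
    (hX : IsCostate A S p₁ X) {a b t k : ℝ} (ha : 0 ≤ a) (hab : a ≤ b) (hbt : b ≤ t)
    (hk : ∀ s ∈ Icc a b, κ ‖p₁ s‖ ≤ k) (v : Fin r → ℝ) :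
    quad (p₂ b - p₁ b) (X b *ᵥ v) - quad (p₂ a - p₁ a) (X a *ᵥ v) ≤
      ‖R₂ - R₁‖ * (k ^ 2 / (4 * ν)) * (X t *ᵥ v ⬝ᵥ X t *ᵥ v) * Real.exp (-(4 * ν * (t - b))) := by
  have hS' := transpose_eq_of_posSemidef hS
  set c := ‖R₂ - R₁‖ * (k ^ 2 / (4 * ν)) * (X t *ᵥ v ⬝ᵥ X t *ᵥ v) with hc
  have hc0 : 0 ≤ c := mul_nonneg (by positivity) (dotProduct_self_nonneg_real _)
  have hg : ∀ s, HasDerivAt (fun s => c * Real.exp (-(4 * ν * (t - s))))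
      (c * (Real.exp (-(4 * ν * (t - s))) * (4 * ν))) s := fun s => by
    have := ((((hasDerivAt_id s).const_sub t).const_mul (4 * ν)).neg.exp).const_mul c
    simpa using this
  have key := sub_le_sub_of_deriv_le ha hab
    (f := fun s => quad ((X s)ᵀ * (p₂ s - p₁ s) * X s) v) (fun s hs =>
      hasDerivWithinAt_quad (hX.deriv_conj hX (ha.trans hs.1)
        ((h₂.2 s (ha.trans hs.1)).2.sub (h₁.2 s (ha.trans hs.1)).2)) v)
    (fun s _ => (hg s).hasDerivWithinAt) fun s hs => by
      have hs0 := ha.trans hs.1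
      have hst := sub_nonneg.2 (hs.2.trans hbt)
      have h3 : ricc A R₂ S (p₂ s) - ricc A R₁ S (p₁ s) - (A - p₁ s * S) * (p₂ s - p₁ s) -
          (p₂ s - p₁ s) * (A - p₁ s * S)ᵀ =
          (R₂ - R₁) - (p₂ s - p₁ s)ᵀ * S * (p₂ s - p₁ s) := by
        rw [ricc_sub_ricc hS' _ _ (h₂.transpose_eq hs0)]
        simp only [Matrix.transpose_sub, Matrix.transpose_mul, hS', h₁.transpose_eq hs0,
          h₂.transpose_eq hs0]
        noncomm_ring
      rw [Pi.sub_apply, h3, quad_conj, quad_sub, quad_conj]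
      -- `X s v` is the image of `X t v` under an inverse costate along the shifted path.
      have hX' := hκ _ _ _ (h₁.shift hs0) (hX.shift hs0) (t - s) hst
      set Z := X (s + (t - s)) * (X s)⁻¹ with hZ
      have hZu : IsUnit Z := (hX.shift hs0).isUnit _ hst
      have hXs : X s *ᵥ v = Z⁻¹ *ᵥ (X t *ᵥ v) := by
        have h4 : X t = Z * X s := by
          rw [hZ, Matrix.mul_assoc, inv_mul_of_isUnit (hX.isUnit s hs0), Matrix.mul_one,
            add_sub_cancel]
        rw [h4, ← Matrix.mulVec_mulVec, Matrix.mulVec_mulVec, inv_mul_of_isUnit hZu,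
          Matrix.one_mulVec]
      have hk0 := hκ.nonneg hR₁ hS (h₁.2 s hs0).1
      have h5 := quad_mulVec_le (R₂ - R₁) Z⁻¹ (hX'.trans (mul_le_mul_of_nonneg_right (hk s hs)
        (Real.exp_pos _).le)) (X t *ᵥ v)
      rw [← hXs] at h5
      have h6 := quad_nonneg hS ((p₂ s - p₁ s) *ᵥ X s *ᵥ v)
      have h7 : Real.exp (-(2 * ν * (t - s))) ^ 2 = Real.exp (-(4 * ν * (t - s))) := by
        rw [← Real.exp_nat_mul]; push_cast; ring_nf
      rw [mul_pow, h7] at h5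
      calc _ ≤ _ := sub_le_self _ h6
        _ ≤ _ := h5
        _ = _ := by rw [hc]; field_simp
  simp only [quad_conj] at key
  have : 0 ≤ c * Real.exp (-(4 * ν * (t - a))) := mul_nonneg hc0 (Real.exp_pos _).le
  linarith

/-- The perturbation of the flow is linear in that of the noise covariance. The time interval is
split at `1`: afterwards the nominal flow lies in an absorbing ball independent of its initial
state, and the contribution of the first unit of time decays. -/
theorem exists_norm_sub_le (hR : R.PosDef) (hS : S.PosSemidef) (hobs : TrivialUnobservable A S)
    {ν : ℝ} {κ : ℝ → ℝ} (hν : 0 < ν) (hmono : Monotone κ) (hκ : IsCostateRate A R S ν κ) :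
    ∃ (χ₁ : ℝ) (χ₂ : ℝ → ℝ), ∀ R₂ : Matrix (Fin r) (Fin r) ℝ, R₂.PosDef →
      (R₂ - R).PosSemidef → ∀ Q p p₂, IsSolution (ricc A R S) Q p →
        IsSolution (ricc A R₂ S) Q p₂ → ∀ t, 0 ≤ t →
          ‖p₂ t - p t‖ ≤ ‖R₂ - R‖ * (χ₁ + Real.exp (-(4 * t * ν)) * χ₂ ‖Q‖) := by
  obtain ⟨b₁, b₀, -, -, hb⟩ := exists_norm_le_of_le_one A R hS
  obtain ⟨B, hB0, hB⟩ := exists_norm_le_of_one_le R hS hobs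
  refine ⟨κ B ^ 2 / (4 * ν), fun q => κ (b₁ * q + b₀) ^ 2 / (4 * ν) * Real.exp (4 * ν),
    fun R₂ hR₂ hG Q p p₂ hp hp₂ t ht => ?_⟩
  obtain ⟨X, hX⟩ := hp.exists_isCostate hR hS hp.posSemidef
  refine norm_le_of_quad_le (hp.sub_posSemidef hR₂ hS hG hp₂ ht) (by positivity) fun x => ?_
  obtain ⟨v, rfl⟩ : ∃ v, X t *ᵥ v = x :=
    ⟨(X t)⁻¹ *ᵥ x, by rw [Matrix.mulVec_mulVec, mul_inv_of_isUnit (hX.isUnit t ht),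
      Matrix.one_mulVec]⟩
  have hx := dotProduct_self_nonneg_real (X t *ᵥ v)
  have h0 : quad (p₂ 0 - p 0) (X 0 *ᵥ v) = 0 := by simp [hp.1, hp₂.1, quad]
  have hfirst : ∀ u, 0 ≤ u → u ≤ 1 → u ≤ t → quad (p₂ u - p u) (X u *ᵥ v) ≤
      ‖R₂ - R‖ * (Real.exp (-(4 * t * ν)) *
        (κ (b₁ * ‖Q‖ + b₀) ^ 2 / (4 * ν) * Real.exp (4 * ν))) * (X t *ᵥ v ⬝ᵥ X t *ᵥ v) := by
    intro u hu hu1 hut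
    have h1 := hp.quad_sub_le hS hν hκ hR hp₂ hX le_rfl hu hut
      (fun s hs => hmono (hb Q p hp s ⟨hs.1, hs.2.trans hu1⟩)) v
    rw [h0, sub_zero] at h1
    refine h1.trans ?_
    have h2 : Real.exp (-(4 * ν * (t - u))) ≤ Real.exp (-(4 * t * ν)) * Real.exp (4 * ν) := by
      rw [← Real.exp_add]
      exact Real.exp_le_exp.2 (by nlinarith)
    have h3 : 0 ≤ ‖R₂ - R‖ * (κ (b₁ * ‖Q‖ + b₀) ^ 2 / (4 * ν)) * (X t *ᵥ v ⬝ᵥ X t *ᵥ v) := by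
      positivity
    exact (mul_le_mul_of_nonneg_left h2 h3).trans_eq (by ring)
  rcases le_total t 1 with h1 | h1
  · have h2 : 0 ≤ ‖R₂ - R‖ * (κ B ^ 2 / (4 * ν)) * (X t *ᵥ v ⬝ᵥ X t *ᵥ v) := by positivity
    have h3 := hfirst t ht h1 le_rfl
    linarith
  · have h2 := hp.quad_sub_le hS hν hκ hR hp₂ hX zero_le_one h1 le_rfl
      (fun s hs => hmono (hB Q p hp s hs.1)) v
    have h3 := hfirst 1 zero_le_one le_rfl h1
    simp only [sub_self, mul_zero, neg_zero, Real.exp_zero, mul_one] at h2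
    linarith

/-! ### Variance inflation -/

/-- The terms of first order in `ε` cancel: inflation by `ε T` adds `ε² T S T` to the noise
covariance. -/
lemma riccReg_inflation (A R S : Matrix (Fin r) (Fin r) ℝ) {T : Matrix (Fin r) (Fin r) ℝ}
    (hT : Tᵀ = T) (hS : Sᵀ = S) (ε : ℝ) {Q : Matrix (Fin r) (Fin r) ℝ} (hQ : Qᵀ = Q) :
    riccReg A R S (inflation T ε) Q = ricc A (R + ε ^ 2 • (T * S * T)) S Q := by
  simp only [riccReg, inflation, ricc, Matrix.transpose_sub, Matrix.transpose_mul,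
    Matrix.transpose_add, Matrix.transpose_smul, hT, hS, hQ]
  simp only [Matrix.add_mul, Matrix.mul_add, Matrix.sub_mul, Matrix.mul_sub, Matrix.smul_mul,
    Matrix.mul_smul, smul_add, smul_smul, ← sq, Matrix.mul_assoc]
  abel

lemma IsSolution.congr {F G : Matrix (Fin r) (Fin r) ℝ → Matrix (Fin r) (Fin r) ℝ}
    (h : ∀ Q : Matrix (Fin r) (Fin r) ℝ, Q.PosSemidef → F Q = G Q)
    {p : ℝ → Matrix (Fin r) (Fin r) ℝ} (hp : IsSolution F Q p) : IsSolution G Q p :=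
  ⟨hp.1, fun t ht => ⟨(hp.2 t ht).1, h _ (hp.2 t ht).1 ▸ (hp.2 t ht).2⟩⟩

lemma IsFlow.congr {F G : Matrix (Fin r) (Fin r) ℝ → Matrix (Fin r) (Fin r) ℝ}
    (h : ∀ Q : Matrix (Fin r) (Fin r) ℝ, Q.PosSemidef → F Q = G Q)
    {φ : ℝ → Matrix (Fin r) (Fin r) ℝ → Matrix (Fin r) (Fin r) ℝ} (hφ : IsFlow F φ) :
    IsFlow G φ :=
  fun Q hQ => ⟨(hφ Q hQ).1.congr h, fun q hq =>
    (hφ Q hQ).2 q (hq.congr fun Q hQ => (h Q hQ).symm)⟩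

lemma IsSteadyState.congr {F G : Matrix (Fin r) (Fin r) ℝ → Matrix (Fin r) (Fin r) ℝ}
    (h : ∀ Q : Matrix (Fin r) (Fin r) ℝ, Q.PosSemidef → F Q = G Q)
    {P : Matrix (Fin r) (Fin r) ℝ} (hP : IsSteadyState F P) : IsSteadyState G P :=
  ⟨hP.1, h P hP.1.posSemidef ▸ hP.2.1, fun P' hP' h' =>
    hP.2.2 P' hP' ((h P' hP'.posSemidef).trans h')⟩

/-- An exponential rate for the transition matrices along the flow is one for the costates. -/
lemma IsRate.exists_isCostateRate {φ : ℝ → Matrix (Fin r) (Fin r) ℝ → Matrix (Fin r) (Fin r) ℝ}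
    (hφ : IsFlow (ricc A R S) φ) {ν : ℝ} (h : IsRate A S φ ν) :
    ∃ κ, Monotone κ ∧ IsCostateRate A R S ν κ := by
  obtain ⟨-, κ, hmono, hκ⟩ := h
  refine ⟨κ, hmono, fun Q p X hp hX t ht => ?_⟩
  obtain ⟨E, hE, hb⟩ := hκ Q hp.posSemidef
  have hE' : IsTransition A S p E :=
    ⟨hE.1, fun s hs => (hφ Q hp.posSemidef).2 p hp s hs ▸ hE.2 s hs⟩
  have := hb t ht
  rwa [hX.eq_transition hE' ht, norm_transpose] at this

lemma exists_isRate (hR : R.PosDef) (hS : S.PosSemidef) (hobs : TrivialUnobservable A S)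
    {φ : ℝ → Matrix (Fin r) (Fin r) ℝ → Matrix (Fin r) (Fin r) ℝ}
    (hφ : IsFlow (ricc A R S) φ) : ∃ ν, IsRate A S φ ν := by
  obtain ⟨ν, hν, κ, hmono, hκ⟩ := exists_costate_rate hR hS hobs
  refine ⟨ν, hν, κ, hmono, fun Q hQ => ?_⟩
  obtain ⟨X, hX⟩ := (hφ Q hQ).1.exists_isCostate hR hS hQ
  refine ⟨_, hX.isTransition, fun t ht => ?_⟩
  rw [norm_transpose]
  exact hκ Q _ X (hφ Q hQ).1 hX t ht

lemma IsSteadyState.tendsto_flow (hR : R.PosDef) (hS : S.PosSemidef)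
    (hobs : TrivialUnobservable A S) {P : Matrix (Fin r) (Fin r) ℝ}
    (hP : IsSteadyState (ricc A R S) P) {p : ℝ → Matrix (Fin r) (Fin r) ℝ}
    (hp : IsSolution (ricc A R S) Q p) : Tendsto p atTop (𝓝 P) := by
  obtain ⟨ν, hν, κ, -, hκ⟩ := exists_costate_rate hR hS hobs
  exact tendsto_sub_nhds_zero_iff.1
    (IsCostateRate.tendsto_sub hκ hν hR hS (isSolution_const hP.1.posSemidef hP.2.1) hp)

lemma sensorMatrix_posSemidef {r' : ℕ} (C : Matrix (Fin r') (Fin r) ℝ)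
    {Sigma : Matrix (Fin r') (Fin r') ℝ} (h : Sigma.PosDef) :
    (sensorMatrix C Sigma).PosSemidef := by
  simpa [sensorMatrix] using h.inv.posSemidef.conjTranspose_mul_mul_same C

end KalmanBucy

theorem corollary4p1 {r r' : ℕ}
    (A R : Matrix (Fin r) (Fin r) ℝ) (C : Matrix (Fin r') (Fin r) ℝ)
    (Sigma : Matrix (Fin r') (Fin r') ℝ) (T : Matrix (Fin r) (Fin r) ℝ)
    (hR : R.PosDef) (hSigma : Sigma.PosDef) (hobs : KalmanBucy.IsObservable A C)
    (hT : T.PosSemidef) :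
    ∃ (φ : ℝ → Matrix (Fin r) (Fin r) ℝ → Matrix (Fin r) (Fin r) ℝ)
      (P : Matrix (Fin r) (Fin r) ℝ),
      KalmanBucy.IsFlow (KalmanBucy.ricc A R (KalmanBucy.sensorMatrix C Sigma)) φ ∧
      KalmanBucy.IsSteadyState (KalmanBucy.ricc A R (KalmanBucy.sensorMatrix C Sigma)) P ∧
      (∃ ν : ℝ, KalmanBucy.IsRate A (KalmanBucy.sensorMatrix C Sigma) φ ν) ∧
      ∀ ν : ℝ, KalmanBucy.IsRate A (KalmanBucy.sensorMatrix C Sigma) φ ν →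
        ∃ δ : ℝ, 0 < δ ∧ δ ≤ 1 ∧ ∃ (χ₁ : ℝ) (χ₂ : ℝ → ℝ),
          ∀ ε : ℝ, 0 ≤ ε → ε ≤ δ →
            ∃ (φε : ℝ → Matrix (Fin r) (Fin r) ℝ → Matrix (Fin r) (Fin r) ℝ)
              (Pε : Matrix (Fin r) (Fin r) ℝ),
              KalmanBucy.IsFlow
                (KalmanBucy.riccReg A R (KalmanBucy.sensorMatrix C Sigma)
                  (KalmanBucy.inflation T ε)) φε ∧
              KalmanBucy.IsSteadyState
                (KalmanBucy.riccReg A R (KalmanBucy.sensorMatrix C Sigma)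
                  (KalmanBucy.inflation T ε)) Pε ∧
              (∀ t : ℝ, 0 ≤ t → ∀ Q : Matrix (Fin r) (Fin r) ℝ, Q.PosSemidef →
                ‖φε t Q - φ t Q‖ ≤ ε ^ 2 * (χ₁ + Real.exp (-(4 * t * ν)) * χ₂ ‖Q‖)) ∧
              ‖Pε - P‖ ≤ ε ^ 2 * χ₁ := by
  open KalmanBucy Filter Topology in
  have hobs' := hobs.trivialUnobservable (C := C) hSigma
  have hS := sensorMatrix_posSemidef C hSigma
  set S := sensorMatrix C Sigma
  obtain ⟨φ, hφ⟩ := exists_isFlow A hR hS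
  obtain ⟨P, hP⟩ := exists_isSteadyState hR hS hobs'
  refine ⟨φ, P, hφ, hP, exists_isRate hR hS hobs' hφ, fun ν hν => ?_⟩
  obtain ⟨κ, hmono, hκ⟩ := hν.exists_isCostateRate hφ
  obtain ⟨χ₁, χ₂, hχ⟩ := exists_norm_sub_le hR hS hobs' hν.1 hmono hκ
  -- The bounds hold for every `ε`, so `δ = 1`.
  refine ⟨1, one_pos, le_rfl, ‖T * S * T‖ * χ₁, fun q => ‖T * S * T‖ * χ₂ q, fun ε _ _ => ?_⟩
  have hT' := transpose_eq_of_posSemidef hT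
  have hN : (ε ^ 2 • (T * S * T)).PosSemidef := by
    have := hS.conjTranspose_mul_mul_same T
    rw [Matrix.conjTranspose_eq_transpose_of_trivial, hT'] at this
    exact this.smul (sq_nonneg ε)
  have hRε : (R + ε ^ 2 • (T * S * T)).PosDef := hR.add_posSemidef hN
  have hdrift : ∀ Q : Matrix (Fin r) (Fin r) ℝ, Q.PosSemidef →
      ricc A (R + ε ^ 2 • (T * S * T)) S Q = riccReg A R S (inflation T ε) Q := fun Q hQ =>
    (riccReg_inflation A R S hT' (transpose_eq_of_posSemidef hS) ε
      (transpose_eq_of_posSemidef hQ)).symm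
  obtain ⟨φε, hφε⟩ := exists_isFlow A hRε hS
  obtain ⟨Pε, hPε⟩ := exists_isSteadyState hRε hS hobs'
  have hbound : ∀ t : ℝ, 0 ≤ t → ∀ Q : Matrix (Fin r) (Fin r) ℝ, Q.PosSemidef →
      ‖φε t Q - φ t Q‖ ≤ ε ^ 2 * (‖T * S * T‖ * χ₁ +
        Real.exp (-(4 * t * ν)) * (‖T * S * T‖ * χ₂ ‖Q‖)) := fun t ht Q hQ => by
    have := hχ _ hRε (by simpa using hN) Q _ _ (hφ Q hQ).1 (hφε Q hQ).1 t ht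
    rw [add_sub_cancel_left, norm_smul, Real.norm_of_nonneg (sq_nonneg ε)] at this
    exact this.trans_eq (by ring)
  refine ⟨φε, Pε, hφε.congr hdrift, hPε.congr hdrift, hbound, ?_⟩
  have h1 := hPε.tendsto_flow hRε hS hobs' (hφε 0 .zero).1
  have h2 := hP.tendsto_flow hR hS hobs' (hφ 0 .zero).1
  have h3 := tendsto_const_mul_exp_neg
    (‖T * S * T‖ * χ₂ ‖(0 : Matrix (Fin r) (Fin r) ℝ)‖) (a := 4 * ν) (by linarith [hν.1])
  have h4 := (h3.const_add (‖T * S * T‖ * χ₁)).const_mul (ε ^ 2)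
  rw [add_zero] at h4
  refine le_of_tendsto_of_tendsto (h1.sub h2).norm h4 ?_
  filter_upwards [eventually_ge_atTop 0] with t ht
  refine (hbound t ht 0 .zero).trans_eq ?_
  rw [mul_comm (Real.exp _), mul_right_comm 4 t ν]
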